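/- **Setting.** For an open set $U\subseteq\mathbb R^n$ let $\mathcal E_M(U)$ be the set of nets $(u_\varepsilon)_{\varepsilon\in(0,1]}$ in $C^\infty(U,\mathbb R)$ such that for every compact $K\subseteq U$ and every multi-index $\kappa$ there is $N\in\mathbb N$ with $\sup_{x\in K}|\partial^\kappa u_\varepsilon(x)|=O(\varepsilon^{-N})$ as $\varepsilon\to0$ (moderate nets), let $\mathcal N(U)$ be the set of those nets for which $\sup_{x\in K}|\partial^\kappa u_\varepsilon(x)|=O(\varepsilon^{m})$ for all $K$, $\kappa$ and all $m\in\mathbb N$, and let $\mathcal G(U)=\mathcal E_M(U)/\mathcal N(U)$ be the special Colombeau algebra. A generalized function on $U$ with values in $\mathbb R^m$ is an element of $\mathcal G(U)^m$. A net of smooth maps $u_\varepsilon:U\to V$, with $V\subseteq\mathbb R^m$ open and with moderate components, is *c-bounded into $V$* if for every compact $K\subseteq U$ there are a compact $L\subseteq V$ and $\varepsilon_0\in(0,1]$ with $u_\varepsilon(K)\subseteq L$ for all $\varepsilon\le\varepsilon_0$; an element of $\mathcal G(U)^m$ is c-bounded into $V$ if it has such a representative, and its composition with $v\in\mathcal G(V)^p$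 is then $v\circ u=[(v_\varepsilon\circ u_\varepsilon)_\varepsilon]$. For $\Omega\subseteq U$ open, $u\in\mathcal G(U)^n$ is *left invertible on $\Omega$* if there are open sets $H\subseteq V\subseteq\mathbb R^n$ and $v\in\mathcal G(V)^n$ such that $u|_\Omega$ is c-bounded into $H$ and $v\circ u|_\Omega=\mathrm{id}_\Omega$ in $\mathcal G(\Omega)^n$. Let $f\in C^\infty(\mathbb R^2,\mathbb R)$, and let $(\delta_\varepsilon)_{\varepsilon\in(0,1]}$ be a strict delta net on $\mathbb R$ that represents an element of $\mathcal G(\mathbb R)$: the net is moderate, $\delta_\varepsilon\in C^\infty(\mathbb R)$, $\operatorname{supp}\delta_\varepsilon\subseteq[-\varepsilon,\varepsilon]$, $\int\delta_\varepsilon\to1$ as $\varepsilon\to0$, and $\int|\delta_\varepsilon|\le C$ for some $C>0$ and all small $\varepsilon$. An *asymptotic solution* of the regularized geodesic equations is a pair of nets of smooth functions $x_\varepsilon=(x^1_\varepsilon,x^2_\varepsilon)(X,U)$ with values in $\mathbb R^2$ and $v_\varepsilon(X,V,U)$ with values in $\mathbb R$, defined for all $X\in\mathbb R^2$ and $V,U\in\mathbb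 R$, such that for every compact $K\subset\mathbb R^2$ there is $\varepsilon_K\in(0,1]$ such that for all $\varepsilon\le\varepsilon_K$, $X\in K$, $V\in\mathbb R$ the functions $x_\varepsilon=x_\varepsilon(X,\cdot)$, $v_\varepsilon=v_\varepsilon(X,V,\cdot)$ satisfy on $\mathbb R$ $$\ddot x^i_\varepsilon=\tfrac12\,\partial_if(x_\varepsilon)\,\delta_\varepsilon\quad(i=1,2),\qquad \ddot v_\varepsilon=f(x_\varepsilon)\,\dot\delta_\varepsilon+2\sum_{i=1}^2\partial_if(x_\varepsilon)\,\dot x^i_\varepsilon\,\delta_\varepsilon,$$ $$x_\varepsilon(-1)=X,\quad \dot x_\varepsilon(-1)=0,\quad v_\varepsilon(-1)=V,\quad \dot v_\varepsilon(-1)=0 .$$ The generalized coordinate transformation is $T=[(t_\varepsilon)_\varepsilon]\in\mathcal G(\mathbb R^4)^4$ with $t_\varepsilon(U,X,V)=(U,x_\varepsilon(X,U),v_\varepsilon(X,V,U))$ for an asymptotic solution $(x_\varepsilon,v_\varepsilon)_\varepsilon$. **Corollary 6.5.** The generalized function $T$ is well defined: there is exactly one element of $\mathcal G(\mathbb R^4)^4$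 of this form. Moreover, for every open relatively compact $W\subset\mathbb R^2$ there is $\alpha>0$ such that for all $\beta>0$ and all bounded open intervals $I$ the generalized function $T$ is left invertible on $(-\beta,\alpha)\times W\times I$. -/

import Mathlib

open Set Filter Topology TopologicalSpace
open scoped ContDiff

namespace PPWave

section Colombeau

variable {E : Type*} [NormedAddCommGroup E] [NormedSpace ℝ E]

/-- Moderate nets `(u_ε)` of smooth real functions on the open set `U`. A net is a function of
`ε : ℝ`, of which only the values at `ε ∈ (0,1]` matter; likewise only the values of `u ε` on `U`
matter. All partial derivatives of order `k` are controlled at once by the norm of the `k`-th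
iterated Fréchet derivative; `∀ᶠ ε in 𝓝[>] 0` means "for all sufficiently small `ε > 0`". -/
structure IsModerate (U : Opens E) (u : ℝ → E → ℝ) : Prop where
  smooth : ∀ ε ∈ Ioc (0 : ℝ) 1, ContDiffOn ℝ ∞ (u ε) U
  growth : ∀ K : Set E, IsCompact K → K ⊆ U → ∀ k : ℕ, ∃ N : ℕ, ∃ C : ℝ,
    ∀ᶠ ε in 𝓝[>] (0 : ℝ), ∀ x ∈ K, ‖iteratedFDeriv ℝ k (u ε) x‖ ≤ C * (ε ^ N)⁻¹

/-- Negligible nets of smooth real functions on the open set `U`. -/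
structure IsNegligible (U : Opens E) (u : ℝ → E → ℝ) : Prop where
  smooth : ∀ ε ∈ Ioc (0 : ℝ) 1, ContDiffOn ℝ ∞ (u ε) U
  decay : ∀ K : Set E, IsCompact K → K ⊆ U → ∀ k m : ℕ, ∃ C : ℝ,
    ∀ᶠ ε in 𝓝[>] (0 : ℝ), ∀ x ∈ K, ‖iteratedFDeriv ℝ k (u ε) x‖ ≤ C * ε ^ m

theorem eventually_mem_Ioc : ∀ᶠ ε in 𝓝[>] (0 : ℝ), ε ∈ Ioc (0 : ℝ) 1 :=
  Ioc_mem_nhdsGT one_pos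

theorem IsNegligible.zero (U : Opens E) : IsNegligible U (fun _ _ => 0) where
  smooth _ _ := contDiffOn_const
  decay K _ _ k m := ⟨0, Eventually.of_forall fun ε x _ => by
    have h : (fun _ : E => (0 : ℝ)) = 0 := rfl
    rw [h, iteratedFDeriv_zero]
    simp⟩

theorem IsNegligible.neg {U : Opens E} {u : ℝ → E → ℝ} (hu : IsNegligible U u) :
    IsNegligible U (fun ε x => -u ε x) where
  smooth ε hε := (hu.smooth ε hε).neg
  decay K hK hKU k m := by
    obtain ⟨C, hC⟩ := hu.decay K hK hKU k m
    refine ⟨C, hC.mono fun ε h x hx => ?_⟩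
    have h2 : (fun x => -u ε x) = -u ε := rfl
    rw [h2, iteratedFDeriv_neg]
    simpa using h x hx

theorem IsNegligible.add {U : Opens E} {u v : ℝ → E → ℝ} (hu : IsNegligible U u)
    (hv : IsNegligible U v) : IsNegligible U (fun ε x => u ε x + v ε x) where
  smooth ε hε := (hu.smooth ε hε).add (hv.smooth ε hε)
  decay K hK hKU k m := by
    obtain ⟨C, hC⟩ := hu.decay K hK hKU k m
    obtain ⟨D, hD⟩ := hv.decay K hK hKU k m
    refine ⟨C + D, ?_⟩
    filter_upwards [hC, hD, eventually_mem_Ioc] with ε h1 h2 hε x hx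
    have hx' : (U : Set E) ∈ 𝓝 x := U.isOpen.mem_nhds (hKU hx)
    have e1 : ContDiffAt ℝ k (u ε) x :=
      ((hu.smooth ε hε).contDiffAt hx').of_le (by exact_mod_cast le_top)
    have e2 : ContDiffAt ℝ k (v ε) x :=
      ((hv.smooth ε hε).contDiffAt hx').of_le (by exact_mod_cast le_top)
    have h3 : (fun x => u ε x + v ε x) = u ε + v ε := rfl
    rw [h3, iteratedFDeriv_add_apply e1 e2, add_mul]
    exact (norm_add_le _ _).trans (add_le_add (h1 x hx) (h2 x hx))

/-- The moderate nets on `U`. -/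
def ModerateNet (U : Opens E) : Type _ := {u : ℝ → E → ℝ // IsModerate U u}

/-- Two moderate nets are identified if their difference is negligible. -/
instance moderateSetoid (U : Opens E) : Setoid (ModerateNet U) where
  r u v := IsNegligible U (fun ε x => u.1 ε x - v.1 ε x)
  iseqv :=
    { refl := fun u => by simpa using IsNegligible.zero U
      symm := fun {u v} h => by simpa using h.neg
      trans := fun {u v w} h1 h2 => by simpa using h1.add h2 }

/-- The special Colombeau algebra `𝒢(U)` (as a set): moderate nets modulo negligible nets. -/
def Colombeau (U : Opens E) : Type _ := Quotient (moderateSetoid U)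

/-- The class `[(u_ε)_ε]` of a moderate net. -/
def Colombeau.mk {U : Opens E} (u : ℝ → E → ℝ) (hu : IsModerate U u) : Colombeau U :=
  Quotient.mk (moderateSetoid U) ⟨u, hu⟩

theorem IsModerate.mono {U Ω : Opens E} (h : Ω ≤ U) {u : ℝ → E → ℝ} (hu : IsModerate U u) :
    IsModerate Ω u where
  smooth ε hε := (hu.smooth ε hε).mono h
  growth K hK hKΩ := hu.growth K hK (hKΩ.trans h)

theorem IsNegligible.mono {U Ω : Opens E} (h : Ω ≤ U) {u : ℝ → E → ℝ} (hu : IsNegligible U u) :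
    IsNegligible Ω u where
  smooth ε hε := (hu.smooth ε hε).mono h
  decay K hK hKΩ := hu.decay K hK (hKΩ.trans h)

/-- The restriction `u|_Ω ∈ 𝒢(Ω)` of `u ∈ 𝒢(U)`, for open `Ω ⊆ U`. -/
def Colombeau.restrict {U Ω : Opens E} (h : Ω ≤ U) : Colombeau U → Colombeau Ω :=
  Quotient.map (fun u => ⟨u.1, u.2.mono h⟩) fun _ _ huv => IsNegligible.mono h huv

theorem IsModerate.const_net (U : Opens E) {σ : E → ℝ} (hσ : ContDiff ℝ ∞ σ) :
    IsModerate U (fun _ => σ) where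
  smooth _ _ := hσ.contDiffOn
  growth K hK _ k := by
    have hc : Continuous (iteratedFDeriv ℝ k σ) :=
      hσ.continuous_iteratedFDeriv (by exact_mod_cast le_top)
    obtain ⟨C, hC⟩ := hK.exists_bound_of_continuousOn hc.continuousOn
    exact ⟨0, C, Eventually.of_forall fun ε x hx => by simpa using hC x hx⟩

/-- An `ℝᵐ`-valued net `u` is a representative of `w ∈ 𝒢(U)ᵐ`: `w = [(u_ε)_ε]`, where a
generalized function with values in `ℝᵐ` is an `m`-tuple of elements of `𝒢(U)`. -/
def IsRepresentative {m : ℕ} (U : Opens E) (u : ℝ → E → Fin m → ℝ)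
    (w : Fin m → Colombeau U) : Prop :=
  ∀ j, ∃ h : IsModerate U (fun ε x => u ε x j), w j = Colombeau.mk (fun ε x => u ε x j) h

/-- c-bounded nets of smooth maps from `U` into `V`. -/
structure IsCBoundedNet {m : ℕ} (U : Opens E) (V : Opens (Fin m → ℝ))
    (u : ℝ → E → Fin m → ℝ) : Prop where
  mapsTo : ∀ ε ∈ Ioc (0 : ℝ) 1, MapsTo (u ε) U V
  moderate : ∀ j, IsModerate U (fun ε x => u ε x j)
  cbounded : ∀ K : Set E, IsCompact K → K ⊆ U → ∃ L : Set (Fin m → ℝ), IsCompact L ∧ L ⊆ V ∧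
    ∃ ε₀ ∈ Ioc (0 : ℝ) 1, ∀ ε ∈ Ioc 0 ε₀, MapsTo (u ε) K L

/-- `u ∈ 𝒢(U)ᵐ` is c-bounded into `V`. -/
def IsCBounded {m : ℕ} {U : Opens E} (u : Fin m → Colombeau U) (V : Opens (Fin m → ℝ)) : Prop :=
  ∃ u' : ℝ → E → Fin m → ℝ, IsCBoundedNet U V u' ∧ IsRepresentative U u' u

/-- `v ∘ u = w` for `u ∈ 𝒢(U)ᵐ` c-bounded into `V`, `v ∈ 𝒢(V)ᵖ` and `w ∈ 𝒢(U)ᵖ`, that is,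
`w = [(v_ε ∘ u_ε)_ε]`, where `(v_ε)` represents `v` and `(u_ε)`, c-bounded into `V`,
represents `u`. -/
def IsComposition {m p : ℕ} {U : Opens E} {V : Opens (Fin m → ℝ)} (v : Fin p → Colombeau V)
    (u : Fin m → Colombeau U) (w : Fin p → Colombeau U) : Prop :=
  ∃ (v' : ℝ → (Fin m → ℝ) → Fin p → ℝ) (u' : ℝ → E → Fin m → ℝ),
    IsRepresentative V v' v ∧ IsCBoundedNet U V u' ∧ IsRepresentative U u' u ∧
      IsRepresentative U (fun ε x => v' ε (u' ε x)) w

end Colombeau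

/-- `id_Ω ∈ 𝒢(Ω)ⁿ`. -/
noncomputable def idGen {n : ℕ} (Ω : Opens (Fin n → ℝ)) : Fin n → Colombeau Ω := fun j =>
  Colombeau.mk (fun _ x => x j) (IsModerate.const_net Ω (contDiff_apply ℝ ℝ j))

/-- `u ∈ 𝒢(U)ⁿ` is left invertible on the open subset `Ω` of `U`. -/
def IsLeftInvertibleOn {n : ℕ} {U : Opens (Fin n → ℝ)} (u : Fin n → Colombeau U)
    (Ω : Opens (Fin n → ℝ)) : Prop :=
  ∃ hΩ : Ω ≤ U, ∃ (V : Opens (Fin n → ℝ)) (v : Fin n → Colombeau V) (H : Opens (Fin n → ℝ)),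
    H ≤ V ∧ IsCBounded (fun j => (u j).restrict hΩ) H ∧
      IsComposition v (fun j => (u j).restrict hΩ) (idGen Ω)

/-- Strict delta nets on `ℝ`; the support condition contains compactness of the support. -/
structure IsStrictDeltaNet (δ : ℝ → ℝ → ℝ) : Prop where
  smooth : ∀ ε ∈ Ioc (0 : ℝ) 1, ContDiff ℝ ∞ (δ ε)
  support : ∀ ε ∈ Ioc (0 : ℝ) 1, tsupport (δ ε) ⊆ Icc (-ε) ε
  tendsto_integral : Tendsto (fun ε => ∫ r, δ ε r) (𝓝[>] 0) (𝓝 1)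
  integral_abs_le : ∃ C > 0, ∀ᶠ ε in 𝓝[>] (0 : ℝ), ∫ r, |δ ε r| ≤ C

/-- The partial derivative `∂ᵢ f (y)`. -/
noncomputable def pderiv (i : Fin 2) (f : (Fin 2 → ℝ) → ℝ) (y : Fin 2 → ℝ) : ℝ :=
  fderiv ℝ f y (Pi.single i 1)

/-- The curve `(ξ, ν)` is a global (smooth) solution of the regularized geodesic equations for the
profile `f` and the regularization `d` of the delta distribution, with initial position `(X, V)`
and vanishing initial velocity at `u = -1`. -/
structure SolvesGeodesic (f : (Fin 2 → ℝ) → ℝ) (d : ℝ → ℝ) (X : Fin 2 → ℝ) (V : ℝ)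
    (ξ : ℝ → Fin 2 → ℝ) (ν : ℝ → ℝ) : Prop where
  smooth_pos : ContDiff ℝ ∞ ξ
  smooth_v : ContDiff ℝ ∞ ν
  eq_pos : ∀ (i : Fin 2) (u : ℝ),
    deriv (deriv fun s => ξ s i) u = 1 / 2 * pderiv i f (ξ u) * d u
  eq_v : ∀ u : ℝ, deriv (deriv ν) u =
    f (ξ u) * deriv d u + 2 * ∑ i : Fin 2, pderiv i f (ξ u) * deriv (fun s => ξ s i) u * d u
  init_pos : ξ (-1) = X
  init_vel : ∀ i : Fin 2, deriv (fun s => ξ s i) (-1) = 0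
  init_v : ν (-1) = V
  init_v_vel : deriv ν (-1) = 0

/-- `(x_ε, v_ε)` is an asymptotic solution of the regularized geodesic equations, regarded as a
smooth function of the initial data `X ∈ ℝ²`, `V ∈ ℝ` and of the curve parameter `u ∈ ℝ`
(arguments in the order `x ε X u`, `v ε X V u`): for `X` in any compact set `K` it consists, for
all `ε` below some `ε_K`, of the global solutions. -/
structure IsAsymptoticSolution (f : (Fin 2 → ℝ) → ℝ) (δ : ℝ → ℝ → ℝ)
    (x : ℝ → (Fin 2 → ℝ) → ℝ → Fin 2 → ℝ) (v : ℝ → (Fin 2 → ℝ) → ℝ → ℝ → ℝ) : Prop where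
  smooth_x : ∀ ε ∈ Ioc (0 : ℝ) 1, ContDiff ℝ ∞ fun q : (Fin 2 → ℝ) × ℝ => x ε q.1 q.2
  smooth_v : ∀ ε ∈ Ioc (0 : ℝ) 1, ContDiff ℝ ∞ fun q : (Fin 2 → ℝ) × ℝ × ℝ => v ε q.1 q.2.1 q.2.2
  solves : ∀ K : Set (Fin 2 → ℝ), IsCompact K → ∃ εK ∈ Ioc (0 : ℝ) 1, ∀ ε ∈ Ioc 0 εK,
    ∀ X ∈ K, ∀ V : ℝ, SolvesGeodesic f (δ ε) X V (x ε X) (v ε X V)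

/-- The net of transformations `t_ε (U, X¹, X², V) = (U, x_ε(X, U), v_ε(X, V, U))` of `ℝ⁴`. -/
def transformationNet (x : ℝ → (Fin 2 → ℝ) → ℝ → Fin 2 → ℝ)
    (v : ℝ → (Fin 2 → ℝ) → ℝ → ℝ → ℝ) (ε : ℝ) (p : Fin 4 → ℝ) : Fin 4 → ℝ :=
  ![p 0, x ε ![p 1, p 2] (p 0) 0, x ε ![p 1, p 2] (p 0) 1, v ε ![p 1, p 2] (p 3) (p 0)]

/-- `T ∈ 𝒢(ℝ⁴)⁴` is the generalized coordinate transformation `[(t_ε)_ε]` determined by the profile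
`f` and the strict delta net `δ`. -/
def IsCoordinateTransformation (f : (Fin 2 → ℝ) → ℝ) (δ : ℝ → ℝ → ℝ)
    (T : Fin 4 → Colombeau (⊤ : Opens (Fin 4 → ℝ))) : Prop :=
  ∃ x v, IsAsymptoticSolution f δ x v ∧ IsRepresentative ⊤ (transformationNet x v) T

/-- The open set `I₀ × W × I` in `ℝ⁴` with coordinates `(U, X¹, X², V)`, where `I₀ = (a, b)` and
`I = (c, d)`. -/
def box (a b : ℝ) (W : Opens (Fin 2 → ℝ)) (c d : ℝ) : Opens (Fin 4 → ℝ) where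
  carrier := {p | p 0 ∈ Ioo a b ∧ ![p 1, p 2] ∈ W ∧ p 3 ∈ Ioo c d}
  is_open' := by
    refine (isOpen_Ioo.preimage (continuous_apply 0)).inter
      (IsOpen.inter ?_ (isOpen_Ioo.preimage (continuous_apply 3)))
    refine W.isOpen.preimage (f := fun p : Fin 4 → ℝ => ![p 1, p 2]) ?_
    refine continuous_pi fun i => ?_
    fin_cases i
    · exact continuous_apply 1
    · exact continuous_apply 2

end PPWave

set_option linter.unusedSectionVars false

/-! Since `δ ε` is supported in [-ε, ε], the spatial equation ẍ = ½∇f(x)δ_ε acts only on a time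
window of length 2ε: the position rests at X before it and moves along a straight line after it.
Once f is cut off outside a large ball, the L¹ bound on `δ ε` makes the acquired velocity bounded,
and Lipschitz in X, with a constant A independent of ε. During the window the position moves by
O(ε), so for small ε trajectories starting in a smaller ball do not notice the cutoff.

Existence with moderate bounds: on the window, rescaled to [0, 1], the displacement solves y = L(½∇f
∘ (X + y)), where L multiplies by the rescaled δ_ε and integrates twice, and ‖L‖ ≤ 3ε∫|δ_ε| → 0. The
implicit function theorem in C([0, 1]) gives y = Y(X, L) with Y smooth and independent of ε
(`exists_solution_operator`). The net enters only through L, which is moderate, and the derivatives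
of Y are bounded near L = 0, so y is moderate (`modNet_comp_of_tendsto_zero`,
`exists_modNet_window`). Integration then yields x and v (`exists_modNet_flow`,
`exists_modNet_geodesic`). The cutoff is removed by letting its radius grow slowly as ε → 0
(`exists_diagonal`).

Well-definedness: by uniqueness for the ODE, two asymptotic solutions coincide over every compact
set for small ε, so the difference of the two transformations is negligible. The same uniqueness
makes the diagonal net locally equal to a moderate one.

Left inverse: X ↦ x_ε(X, U) - X has Lipschitz constant A·max(U + ε, 0). This is at most ½ for U up
to 2α, and it vanishes for U ≤ -ε, which is why β is arbitrary. Banach's fixed point theorem inverts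
X ↦ x_ε(X, U), and the inverse is moderate because its derivative is a moderate function of itself
(`ModNet.fixedPoint`). The last component is V + w_ε(X, U), inverted by subtraction for every V, so
I is arbitrary too. -/

namespace PPWave

/-! ### Smooth superposition and currying on spaces of continuous functions. -/

section FunctionSpaces

variable {S : Type} [TopologicalSpace S] [CompactSpace S]
  {E F G : Type} [NormedAddCommGroup E] [NormedSpace ℝ E] [NormedAddCommGroup F] [NormedSpace ℝ F]
  [NormedAddCommGroup G] [NormedSpace ℝ G]

/-- The pointwise extension of a bounded bilinear map to spaces of continuous functions. -/
noncomputable def pointwiseBilin (B : E →L[ℝ] F →L[ℝ] G) : C(S, E) →L[ℝ] C(S, F) →L[ℝ] C(S, G) :=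
  LinearMap.mkContinuous₂
    (LinearMap.mk₂ ℝ
      (fun (a : C(S, E)) (h : C(S, F)) => (⟨fun s => B (a s) (h s), by fun_prop⟩ : C(S, G)))
      (fun a b h => by ext s; simp) (fun c a h => by ext s; simp)
      (fun a h k => by ext s; simp) (fun c a h => by ext s; simp))
    ‖B‖ fun a h => by
      rw [ContinuousMap.norm_le _ (by positivity)]
      intro s
      refine (B.le_opNorm₂ _ _).trans ?_
      gcongr
      · exact a.norm_coe_le_norm s
      · exact h.norm_coe_le_norm s

@[simp] theorem pointwiseBilin_apply (B : E →L[ℝ] F →L[ℝ] G) (a : C(S, E)) (h : C(S, F)) (s : S) :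
    pointwiseBilin B a h s = B (a s) (h s) := rfl

/-- Constant functions, as a continuous linear map. -/
noncomputable def constFun (S : Type) [TopologicalSpace S] [CompactSpace S] (E : Type)
    [NormedAddCommGroup E] [NormedSpace ℝ E] : E →L[ℝ] C(S, E) :=
  LinearMap.mkContinuous
    { toFun := fun x => ContinuousMap.const S x
      map_add' := fun x y => by ext; simp
      map_smul' := fun c x => by ext; simp } 1 fun x => by
      rw [ContinuousMap.norm_le _ (by positivity)]
      intro s
      simp

@[simp] theorem constFun_apply (x : E) (s : S) : constFun S E x s = x := rfl

/-- The composition operator `y ↦ Φ ∘ y` on spaces of continuous functions. -/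
def superpose (S : Type) [TopologicalSpace S] (Φ : C(E, F)) (y : C(S, E)) : C(S, F) := Φ.comp y

@[simp] theorem superpose_apply (Φ : C(E, F)) (y : C(S, E)) (s : S) :
    superpose S Φ y s = Φ (y s) := rfl

/-- The mean value inequality must hold with one radius for all s. Continuity in the sup norm of
postcomposition with Φ' supplies it: it is tested on y shifted by the constant z - y s. -/
theorem hasFDerivAt_superpose (Φ : C(E, F)) (hΦ : Differentiable ℝ Φ)
    (hc : Continuous (fderiv ℝ Φ)) (y : C(S, E)) :
    HasFDerivAt (superpose S Φ)
      (pointwiseBilin (ContinuousLinearMap.id ℝ (E →L[ℝ] F)) (superpose S ⟨fderiv ℝ Φ, hc⟩ y)) y := by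
  rw [hasFDerivAt_iff_isLittleO_nhds_zero, Asymptotics.isLittleO_iff]
  intro c hc0
  have hcont : Continuous (superpose S ⟨fderiv ℝ Φ, hc⟩) :=
    ContinuousMap.continuous_postcomp _
  obtain ⟨r, hr, H⟩ := Metric.continuous_iff.1 hcont y c hc0
  filter_upwards [Metric.ball_mem_nhds (0 : C(S, E)) hr] with h hh
  rw [ContinuousMap.norm_le _ (by positivity)]
  intro s
  have key : ∀ z ∈ Metric.ball (y s) r, ‖fderiv ℝ Φ z - fderiv ℝ Φ (y s)‖ ≤ c := by
    intro z hz
    have h1 := H (y + constFun S E (z - y s)) (by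
      rw [dist_eq_norm, add_sub_cancel_left, ← norm_neg]
      refine lt_of_le_of_lt ?_ hz
      rw [ContinuousMap.norm_le _ dist_nonneg]
      intro t
      simp [dist_eq_norm, norm_sub_rev])
    rw [dist_eq_norm] at h1
    have h2 := (ContinuousMap.norm_coe_le_norm _ s).trans h1.le
    simpa using h2
  have h3 := (convex_ball (y s) r).norm_image_sub_le_of_norm_hasFDerivWithin_le' (f := Φ)
    (f' := fderiv ℝ Φ) (φ := fderiv ℝ Φ (y s)) (C := c) (x := y s) (y := y s + h s)
    (fun z _ => (hΦ z).hasFDerivAt.hasFDerivWithinAt) key (Metric.mem_ball_self hr) (by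
      rw [mem_ball_iff_norm, add_sub_cancel_left]
      refine lt_of_le_of_lt (h.norm_coe_le_norm s) ?_
      simpa using hh)
  rw [add_sub_cancel_left] at h3
  refine le_trans (le_of_eq ?_) (h3.trans ?_)
  · simp
  · gcongr
    exact h.norm_coe_le_norm s

/-- The derivative of y ↦ Φ ∘ y is multiplication by Φ' ∘ y, again a superposition followed by a
continuous linear map. The target space varies in the induction because Φ' takes values in E →L F.
-/
theorem contDiff_superpose_nat (n : ℕ) : ∀ {F : Type} [NormedAddCommGroup F] [NormedSpace ℝ F]
    (Φ : C(E, F)), ContDiff ℝ n Φ → ContDiff ℝ n (superpose S Φ) := by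
  induction n with
  | zero =>
    intro F _ _ Φ _
    exact contDiff_zero.2 (ContinuousMap.continuous_postcomp Φ)
  | succ n ih =>
    intro F _ _ Φ hΦ
    have hd : Differentiable ℝ Φ := hΦ.differentiable (by simp)
    have hc : ContDiff ℝ n (fderiv ℝ Φ) := hΦ.fderiv_right (by simp)
    push_cast
    rw [contDiff_succ_iff_hasFDerivAt]
    refine ⟨_, ?_, fun y => hasFDerivAt_superpose Φ hd hc.continuous y⟩
    exact ContDiff.comp (ContinuousLinearMap.contDiff (𝕜 := ℝ)
      (pointwiseBilin (S := S) (ContinuousLinearMap.id ℝ (E →L[ℝ] F))))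
      (ih ⟨fderiv ℝ Φ, hc.continuous⟩ hc)

theorem contDiff_superpose (Φ : C(E, F)) (hΦ : ContDiff ℝ ∞ Φ) : ContDiff ℝ ∞ (superpose S Φ) :=
  contDiff_infty.2 fun n => contDiff_superpose_nat n Φ (contDiff_infty.1 hΦ n)

/-- Currying of functions of a parameter and a variable in the unit interval. -/
def curryUnit (g : C(E × ℝ, F)) (p : E) : C(unitInterval, F) :=
  ⟨fun q => g (p, q), by fun_prop⟩

@[simp] theorem curryUnit_apply (g : C(E × ℝ, F)) (p : E) (q : unitInterval) :
    curryUnit g p q = g (p, q) := rfl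

theorem contDiff_curryUnit (g : C(E × ℝ, F)) (hg : ContDiff ℝ ∞ g) :
    ContDiff ℝ ∞ (curryUnit g) := by
  have h : curryUnit g = fun p => superpose unitInterval g
      (constFun unitInterval (E × ℝ) (p, 0) + ⟨fun q => (0, (q : ℝ)), by fun_prop⟩) := by
    ext p q
    simp
  rw [h]
  refine (contDiff_superpose g hg).comp ?_
  refine ((constFun unitInterval (E × ℝ)).contDiff.comp ?_).add contDiff_const
  fun_prop

/-- Evaluation at q is linear and commutes with differentiation, so the value at q of the k-th
derivative is the derivative of g at (p, q) in the directions (mᵢ, 0). -/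
theorem norm_iteratedFDeriv_curryUnit_le (g : C(E × ℝ, F)) (hg : ContDiff ℝ ∞ g) (k : ℕ) (p : E)
    {C : ℝ} (hC : 0 ≤ C) (h : ∀ q ∈ Icc (0 : ℝ) 1, ‖iteratedFDeriv ℝ k g (p, q)‖ ≤ C) :
    ‖iteratedFDeriv ℝ k (curryUnit g) p‖ ≤ C := by
  refine ContinuousMultilinearMap.opNorm_le_bound hC fun m => ?_
  rw [ContinuousMap.norm_le _ (by positivity)]
  intro q
  have hcg := (contDiff_curryUnit g hg).contDiffAt (x := p)
  have h1 := (ContinuousMap.evalCLM ℝ (M := F) q).iteratedFDeriv_comp_left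
    (i := k) hcg (by exact_mod_cast le_top)
  have h2 : (ContinuousMap.evalCLM ℝ (M := F) q) ∘ curryUnit g
      = fun p => (fun z => g (z + (0, (q : ℝ)))) (ContinuousLinearMap.inl ℝ E ℝ p) := by
    ext p
    simp [ContinuousMap.evalCLM]
  have h3 : iteratedFDeriv ℝ k (curryUnit g) p m q
      = iteratedFDeriv ℝ k ((ContinuousMap.evalCLM ℝ (M := F) q) ∘ curryUnit g) p m := by
    rw [h1]; rfl
  have hg' : ContDiff ℝ ∞ (fun z => g (z + (0, (q : ℝ)))) :=
    hg.comp (contDiff_id.add contDiff_const)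
  rw [h3, h2]
  have h4 := (ContinuousLinearMap.inl ℝ E ℝ).iteratedFDeriv_comp_right hg' p
    (i := k) (by exact_mod_cast le_top)
  simp only [Function.comp_def] at h4
  rw [h4, iteratedFDeriv_comp_add_right, ContinuousMultilinearMap.compContinuousLinearMap_apply]
  refine (ContinuousMultilinearMap.le_opNorm _ _).trans ?_
  refine mul_le_mul ?_ ?_ (by positivity) hC
  · simpa using h q q.2
  · refine Finset.prod_le_prod (fun _ _ => norm_nonneg _) fun i _ => ?_
    simp
end FunctionSpaces

/-! ### Volterra operators and the second order integral operator. -/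

section Volterra

variable {E : Type} [NormedAddCommGroup E] [NormedSpace ℝ E]

/-- The Volterra operator `(J h)(r) = ∫₀ʳ h` on continuous functions on the unit interval. -/
noncomputable def volterra (E : Type) [NormedAddCommGroup E] [NormedSpace ℝ E] [CompleteSpace E] :
    C(unitInterval, E) →L[ℝ] C(unitInterval, E) :=
  LinearMap.mkContinuous
    { toFun := fun h => ⟨fun r => ∫ q in (0 : ℝ)..r, IccExtend zero_le_one h q,
        (intervalIntegral.continuous_primitive
          (fun a b => (h.continuous.Icc_extend' (h := zero_le_one)).intervalIntegrable a b) 0).comp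
            continuous_subtype_val⟩
      map_add' := fun h k => by
        ext r
        simp only [ContinuousMap.coe_mk, ContinuousMap.add_apply]
        rw [← intervalIntegral.integral_add
          ((h.continuous.Icc_extend' (h := zero_le_one)).intervalIntegrable _ _)
          ((k.continuous.Icc_extend' (h := zero_le_one)).intervalIntegrable _ _)]
        rfl
      map_smul' := fun c h => by
        ext r
        simp only [ContinuousMap.coe_mk, ContinuousMap.smul_apply, RingHom.id_apply]
        rw [← intervalIntegral.integral_smul]
        rfl } 1 fun h => by
    rw [ContinuousMap.norm_le _ (by positivity)]
    intro r
    refine (intervalIntegral.norm_integral_le_of_norm_le_const (C := ‖h‖) fun q _ =>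
      h.norm_coe_le_norm _).trans ?_
    have : |(r : ℝ) - 0| ≤ 1 := by rw [sub_zero, abs_of_nonneg r.2.1]; exact r.2.2
    rw [one_mul]
    exact mul_le_of_le_one_right (norm_nonneg _) this

variable [CompleteSpace E]

theorem volterra_apply (h : C(unitInterval, E)) (r : unitInterval) :
    volterra E h r = ∫ q in (0 : ℝ)..r, IccExtend zero_le_one h q := rfl

theorem volterra_apply_of_eqOn (h : C(unitInterval, E)) (g : ℝ → E)
    (hg : ∀ q : unitInterval, h q = g q) (r : unitInterval) :
    volterra E h r = ∫ q in (0 : ℝ)..r, g q := by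
  rw [volterra_apply]
  refine intervalIntegral.integral_congr fun q hq => ?_
  rw [uIcc_of_le r.2.1] at hq
  have hq' : q ∈ Icc (0 : ℝ) 1 := ⟨hq.1, hq.2.trans r.2.2⟩
  simp only [IccExtend_of_mem _ _ hq', hg]

theorem norm_volterra_le (h : C(unitInterval, E)) : ‖volterra E h‖ ≤ ‖h‖ := by
  simpa using (volterra E).le_of_opNorm_le (LinearMap.mkContinuous_norm_le _ zero_le_one _) h

/-- The operator `h ↦ J (J (d h))`, solving `y'' = d h`, `y(0) = y'(0) = 0`, as a function of the
coefficient `d`. -/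
noncomputable def secondOrderOp (E : Type) [NormedAddCommGroup E] [NormedSpace ℝ E]
    [CompleteSpace E] : C(unitInterval, ℝ) →L[ℝ] C(unitInterval, E) →L[ℝ] C(unitInterval, E) :=
  (ContinuousLinearMap.compL ℝ C(unitInterval, E) C(unitInterval, E) C(unitInterval, E)
    (volterra E ∘L volterra E)) ∘L pointwiseBilin (ContinuousLinearMap.lsmul ℝ ℝ)

theorem secondOrderOp_apply (d : C(unitInterval, ℝ)) (h : C(unitInterval, E)) :
    secondOrderOp E d h
      = volterra E (volterra E (pointwiseBilin (ContinuousLinearMap.lsmul ℝ ℝ) d h)) := rfl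

/-- Only the L¹ norm of the coefficient enters, the quantity a strict delta net controls: the inner
integration absorbs it and the outer one has norm at most 1. -/
theorem norm_secondOrderOp_le (d : C(unitInterval, ℝ)) (g : ℝ → ℝ)
    (hg : ∀ q : unitInterval, d q = g q) :
    ‖secondOrderOp E d‖ ≤ ∫ q in (0 : ℝ)..1, |g q| := by
  have hext : ∀ q ∈ Icc (0 : ℝ) 1, IccExtend zero_le_one d q = g q := fun q hq => by
    rw [IccExtend_of_mem _ _ hq, hg]
  have hcd : Continuous (IccExtend zero_le_one d) := d.continuous.Icc_extend'
  have h0 : ∫ q in (0 : ℝ)..1, |g q| = ∫ q in (0 : ℝ)..1, |IccExtend zero_le_one d q| := by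
    refine intervalIntegral.integral_congr fun q hq => ?_
    rw [uIcc_of_le zero_le_one] at hq
    simp only [hext q hq]
  rw [h0]
  have hnn : 0 ≤ ∫ q in (0 : ℝ)..1, |IccExtend zero_le_one d q| :=
    intervalIntegral.integral_nonneg zero_le_one fun _ _ => abs_nonneg _
  refine ContinuousLinearMap.opNorm_le_bound _ hnn fun h => ?_
  rw [secondOrderOp_apply]
  refine (norm_volterra_le _).trans ?_
  rw [ContinuousMap.norm_le _ (by positivity)]
  intro r
  rw [volterra_apply]
  have hb : ∀ q : ℝ, ‖IccExtend zero_le_one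
      (pointwiseBilin (ContinuousLinearMap.lsmul ℝ ℝ) d h) q‖
      ≤ |IccExtend zero_le_one d q| * ‖h‖ := fun q => by
    simp only [IccExtend, Function.comp_apply, pointwiseBilin_apply, ContinuousLinearMap.lsmul_apply,
      norm_smul, Real.norm_eq_abs]
    gcongr
    exact h.norm_coe_le_norm _
  refine (intervalIntegral.norm_integral_le_of_norm_le (g := fun q =>
    |IccExtend zero_le_one d q| * ‖h‖) r.2.1 (Eventually.of_forall fun q _ => hb q)
    ((hcd.abs.mul continuous_const).intervalIntegrable _ _)).trans ?_
  rw [← intervalIntegral.integral_mul_const]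
  refine intervalIntegral.integral_mono_interval le_rfl r.2.1 r.2.2
    (Eventually.of_forall fun q => by positivity)
    ((hcd.abs.mul continuous_const).intervalIntegrable _ _)

end Volterra

/-! ### Fixed points of contractions depending on a parameter. -/

section FixedPoint

variable {P B : Type*} [NormedAddCommGroup P] [NormedSpace ℝ P] [NormedAddCommGroup B]
  [NormedSpace ℝ B]

theorem exists_fixedPoint_of_norm_sub_le [CompleteSpace B] (Φ : B → B) {κ : ℝ} (h0 : 0 ≤ κ)
    (h1 : κ < 1) (h : ∀ y z, ‖Φ y - Φ z‖ ≤ κ * ‖y - z‖) : ∃ y, Φ y = y := by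
  have hc : ContractingWith ⟨κ, h0⟩ Φ :=
    ⟨by exact_mod_cast h1, LipschitzWith.of_dist_le_mul fun y z => by
      rw [dist_eq_norm, dist_eq_norm]; exact h y z⟩
  exact ⟨_, hc.fixedPoint_isFixedPt⟩

theorem fixedPoint_unique_of_norm_sub_le (Φ : B → B) {κ : ℝ}
    (h1 : κ < 1) (h : ∀ y z, ‖Φ y - Φ z‖ ≤ κ * ‖y - z‖) {y z : B} (hy : Φ y = y) (hz : Φ z = z) :
    y = z := by
  have := h y z
  rw [hy, hz] at this
  rw [← sub_eq_zero, ← norm_le_zero_iff]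
  nlinarith [norm_nonneg (y - z)]

theorem norm_fderiv_comp_inr_le {Ψ : P × B → B} {p : P} {y : B}
    (hd : DifferentiableAt ℝ Ψ (p, y)) {κ : ℝ} (h0 : 0 ≤ κ)
    (h : ∀ y z, ‖Ψ (p, y) - Ψ (p, z)‖ ≤ κ * ‖y - z‖) :
    ‖fderiv ℝ Ψ (p, y) ∘L ContinuousLinearMap.inr ℝ P B‖ ≤ κ := by
  have h2 : HasFDerivAt (fun z => Ψ (p, z)) (fderiv ℝ Ψ (p, y) ∘L ContinuousLinearMap.inr ℝ P B) y :=
    hd.hasFDerivAt.comp y (hasFDerivAt_prodMk_right p y)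
  exact h2.le_of_lip' h0 (Eventually.of_forall fun z => h z y)

/-- Fixed points of a smooth family of contractions depend smoothly on the parameter. -/
theorem contDiffAt_fixedPoint [CompleteSpace P] [CompleteSpace B] {Ψ : P × B → B}
    (hΨ : ContDiff ℝ ∞ Ψ) {O : Set P} (hO : IsOpen O)
    (hL : ∀ p ∈ O, ∃ κ : ℝ, 0 ≤ κ ∧ κ < 1 ∧ ∀ y z, ‖Ψ (p, y) - Ψ (p, z)‖ ≤ κ * ‖y - z‖)
    {Y : P → B} (hY : ∀ p ∈ O, Ψ (p, Y p) = Y p) {p : P} (hp : p ∈ O) : ContDiffAt ℝ ∞ Y p := by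
  obtain ⟨κ, h0, h1, h⟩ := hL p hp
  have hf : ContDiff ℝ ∞ fun z : P × B => z.2 - Ψ z := contDiff_snd.sub hΨ
  have hd : DifferentiableAt ℝ Ψ (p, Y p) := hΨ.contDiffAt.differentiableAt (by simp)
  have hinv : (fderiv ℝ (fun z : P × B => z.2 - Ψ z) (p, Y p) ∘L .inr ℝ P B).IsInvertible := by
    have hu : IsUnit (1 - fderiv ℝ Ψ (p, Y p) ∘L .inr ℝ P B) :=
      isUnit_one_sub_of_norm_lt_one ((norm_fderiv_comp_inr_le hd h0 h).trans_lt h1)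
    obtain ⟨e, he⟩ := hu
    refine ⟨ContinuousLinearEquiv.unitsEquiv ℝ B e, ?_⟩
    rw [fderiv_fun_sub differentiableAt_snd hd]
    ext y
    have := congrArg (fun T : B →L[ℝ] B => T y) he
    simpa [fderiv_snd] using this
  have hfa := hf.contDiffAt (x := (p, Y p))
  have hz := hfa.eventually_apply_implicitFunction (by simp) hinv
  refine (hfa.contDiffAt_implicitFunction (by simp) hinv).congr_of_eventuallyEq ?_
  filter_upwards [hz, hO.mem_nhds hp] with q hq hqO
  -- No continuity of Y is assumed: the implicit function also consists of fixed points near p, and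
  -- global uniqueness of fixed points identifies it with Y.
  obtain ⟨κ', h0', h1', h'⟩ := hL q hqO
  simp only [hY p hp, sub_self, sub_eq_zero] at hq
  exact fixedPoint_unique_of_norm_sub_le _ h1' h' (hY q hqO) hq.symm

end FixedPoint
-- Polynomial growth in 1/ε.
section PolyBdd

variable {ι : Type*} {K : Set ι} {φ ψ : ℝ → ι → ℝ}

/-- The net `φ` grows at most polynomially in `1/ε`, uniformly on `K`. -/
def PolyBdd (K : Set ι) (φ : ℝ → ι → ℝ) : Prop :=
  ∃ N : ℕ, ∀ᶠ ε in 𝓝[>] (0 : ℝ), ∀ x ∈ K, φ ε x ≤ (ε ^ N)⁻¹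

theorem inv_pow_le_inv_pow {ε : ℝ} (h : ε ∈ Ioc (0 : ℝ) 1) {M N : ℕ} (hMN : M ≤ N) :
    (ε ^ M)⁻¹ ≤ (ε ^ N)⁻¹ :=
  inv_anti₀ (pow_pos h.1 _) (pow_le_pow_of_le_one h.1.le h.2 hMN)

theorem one_le_inv_pow {ε : ℝ} (h : ε ∈ Ioc (0 : ℝ) 1) (N : ℕ) : 1 ≤ (ε ^ N)⁻¹ := by
  simpa using inv_pow_le_inv_pow h (Nat.zero_le N)

theorem eventually_le_inv (C : ℝ) : ∀ᶠ ε in 𝓝[>] (0 : ℝ), C ≤ ε⁻¹ :=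
  tendsto_inv_nhdsGT_zero.eventually_ge_atTop C

theorem PolyBdd.mono (hψ : PolyBdd K ψ) (h : ∀ᶠ ε in 𝓝[>] (0 : ℝ), ∀ x ∈ K, φ ε x ≤ ψ ε x) :
    PolyBdd K φ := by
  obtain ⟨N, hN⟩ := hψ
  exact ⟨N, by filter_upwards [hN, h] with ε h1 h2 x hx using (h2 x hx).trans (h1 x hx)⟩

/-- The constant is absorbed by one further power of 1/ε. -/
theorem PolyBdd.of_le {C : ℝ} {N : ℕ}
    (h : ∀ᶠ ε in 𝓝[>] (0 : ℝ), ∀ x ∈ K, φ ε x ≤ C * (ε ^ N)⁻¹) : PolyBdd K φ := by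
  refine ⟨N + 1, ?_⟩
  filter_upwards [h, eventually_le_inv C, eventually_mem_Ioc] with ε h1 h2 h3 x hx
  refine (h1 x hx).trans ?_
  rw [pow_succ', mul_inv]
  have := pow_pos h3.1 N
  gcongr

theorem PolyBdd.of_le_const {C : ℝ} (h : ∀ᶠ ε in 𝓝[>] (0 : ℝ), ∀ x ∈ K, φ ε x ≤ C) :
    PolyBdd K φ :=
  PolyBdd.of_le (C := C) (N := 0) (by simpa using h)

theorem PolyBdd.mul (hφ : PolyBdd K φ) (hψ : PolyBdd K ψ)
    (h0 : ∀ᶠ ε in 𝓝[>] (0 : ℝ), ∀ x ∈ K, 0 ≤ ψ ε x) : PolyBdd K fun ε x => φ ε x * ψ ε x := by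
  obtain ⟨M, hM⟩ := hφ
  obtain ⟨N, hN⟩ := hψ
  refine ⟨M + N, ?_⟩
  filter_upwards [hM, hN, h0, eventually_mem_Ioc] with ε h1 h2 h3 h4 x hx
  rw [pow_add, mul_inv]
  have := pow_pos h4.1 M
  exact mul_le_mul (h1 x hx) (h2 x hx) (h3 x hx) (by positivity)

theorem PolyBdd.const_mul (hφ : PolyBdd K φ) {C : ℝ} (hC : 0 ≤ C) :
    PolyBdd K fun ε x => C * φ ε x := by
  obtain ⟨N, hN⟩ := hφ
  exact PolyBdd.of_le (C := C) (N := N) <| hN.mono fun ε h x hx =>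
    mul_le_mul_of_nonneg_left (h x hx) hC

theorem PolyBdd.add (hφ : PolyBdd K φ) (hψ : PolyBdd K ψ) :
    PolyBdd K fun ε x => φ ε x + ψ ε x := by
  obtain ⟨M, hM⟩ := hφ
  obtain ⟨N, hN⟩ := hψ
  refine PolyBdd.of_le (C := 2) (N := max M N) ?_
  filter_upwards [hM, hN, eventually_mem_Ioc] with ε h1 h2 h4 x hx
  have h5 := inv_pow_le_inv_pow h4 (le_max_left M N)
  have h6 := inv_pow_le_inv_pow h4 (le_max_right M N)
  linarith [h1 x hx, h2 x hx]

theorem PolyBdd.sum {κ : Type*} (s : Finset κ) {φ : κ → ℝ → ι → ℝ}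
    (h : ∀ i ∈ s, PolyBdd K (φ i)) : PolyBdd K fun ε x => ∑ i ∈ s, φ i ε x := by
  classical
  induction s using Finset.induction_on with
  | empty => exact PolyBdd.of_le_const (C := 0) (by simp)
  | insert a s ha ih =>
    simp only [Finset.sum_insert ha]
    exact (h a (by simp)).add (ih fun i hi => h i (by simp [hi]))

theorem exists_uniform_polyBdd {φ : ℕ → ℝ → ι → ℝ} (h : ∀ k, PolyBdd K (φ k)) (n : ℕ) :
    ∃ N : ℕ, ∀ᶠ ε in 𝓝[>] (0 : ℝ), ∀ x ∈ K, ∀ i ≤ n, φ i ε x ≤ (ε ^ N)⁻¹ := by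
  choose N hN using h
  refine ⟨(Finset.range (n + 1)).sup N, ?_⟩
  have : ∀ᶠ ε in 𝓝[>] (0 : ℝ), ∀ i ∈ Finset.range (n + 1), ∀ x ∈ K, φ i ε x ≤ (ε ^ N i)⁻¹ :=
    (Filter.eventually_all_finset _).2 fun i _ => hN i
  filter_upwards [this, eventually_mem_Ioc] with ε h1 h2 x hx i hi
  have hi' : i ∈ Finset.range (n + 1) := by simpa using Nat.lt_succ_of_le hi
  exact (h1 i hi' x hx).trans (inv_pow_le_inv_pow h2 (Finset.le_sup hi'))

end PolyBdd

/-! ### Calculus of moderate nets between normed spaces. -/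

section ModNet

variable {E F G H : Type*} [NormedAddCommGroup E] [NormedSpace ℝ E] [NormedAddCommGroup F]
  [NormedSpace ℝ F] [NormedAddCommGroup G] [NormedSpace ℝ G] [NormedAddCommGroup H]
  [NormedSpace ℝ H]

/-- Moderate nets of smooth maps between normed spaces, where smoothness is required for small `ε`
only. -/
structure ModNet (u : ℝ → E → F) : Prop where
  smooth : ∀ᶠ ε in 𝓝[>] (0 : ℝ), ContDiff ℝ ∞ (u ε)
  growth : ∀ K : Set E, IsCompact K → ∀ k : ℕ, PolyBdd K fun ε x => ‖iteratedFDeriv ℝ k (u ε) x‖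

/-- For small `ε`, the net maps compact sets into a fixed compact set. -/
def CBdd (u : ℝ → E → F) : Prop :=
  ∀ K : Set E, IsCompact K → ∃ L : Set F, IsCompact L ∧ ∀ᶠ ε in 𝓝[>] (0 : ℝ), MapsTo (u ε) K L

theorem CBdd.of_continuous {g : E → F} (hg : Continuous g) : CBdd fun _ => g := fun K hK =>
  ⟨g '' K, hK.image hg, Eventually.of_forall fun _ => mapsTo_image g K⟩

theorem CBdd.of_norm_le [ProperSpace F] {u : ℝ → E → F}
    (h : ∀ K : Set E, IsCompact K → ∃ C : ℝ, ∀ᶠ ε in 𝓝[>] (0 : ℝ), ∀ x ∈ K, ‖u ε x‖ ≤ C) :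
    CBdd u := fun K hK => by
  obtain ⟨C, hC⟩ := h K hK
  exact ⟨Metric.closedBall 0 C, isCompact_closedBall _ _, hC.mono fun ε h x hx => by
    simpa using h x hx⟩

theorem CBdd.prodMk {u : ℝ → E → F} {v : ℝ → E → G} (hu : CBdd u) (hv : CBdd v) :
    CBdd fun ε x => (u ε x, v ε x) := fun K hK => by
  obtain ⟨L, hL, h1⟩ := hu K hK
  obtain ⟨M, hM, h2⟩ := hv K hK
  refine ⟨L ×ˢ M, hL.prod hM, ?_⟩
  filter_upwards [h1, h2] with ε h3 h4 x hx using ⟨h3 hx, h4 hx⟩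

theorem CBdd.comp {u : ℝ → E → F} {v : ℝ → F → G} (hv : CBdd v) (hu : CBdd u) :
    CBdd fun ε x => v ε (u ε x) := fun K hK => by
  obtain ⟨L, hL, h1⟩ := hu K hK
  obtain ⟨M, hM, h2⟩ := hv L hL
  refine ⟨M, hM, ?_⟩
  filter_upwards [h1, h2] with ε h3 h4 x hx using h4 (h3 hx)

theorem ModNet.congr {u v : ℝ → E → F} (hu : ModNet u) (h : ∀ᶠ ε in 𝓝[>] (0 : ℝ), v ε = u ε) :
    ModNet v where
  smooth := by filter_upwards [hu.smooth, h] with ε h1 h2; rwa [h2]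
  growth K hK k := (hu.growth K hK k).mono (by
    filter_upwards [h] with ε h2 x _; rw [h2])

/-- Moderateness is a local property. -/
theorem ModNet.of_eqOn {u : ℝ → E → F} (hs : ∀ᶠ ε in 𝓝[>] (0 : ℝ), ContDiff ℝ ∞ (u ε))
    (h : ∀ K : Set E, IsCompact K → ∃ O : Set E, IsOpen O ∧ K ⊆ O ∧ ∃ v : ℝ → E → F, ModNet v ∧
      ∀ᶠ ε in 𝓝[>] (0 : ℝ), EqOn (u ε) (v ε) O) : ModNet u where
  smooth := hs
  growth K hK k := by
    obtain ⟨O, hO, hKO, v, hv, huv⟩ := h K hK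
    refine (hv.growth K hK k).mono ?_
    filter_upwards [huv] with ε h2 x hx
    have : u ε =ᶠ[𝓝 x] v ε := h2.eventuallyEq_of_mem (hO.mem_nhds (hKO hx))
    rw [this.iteratedFDeriv ℝ k |>.eq_of_nhds]

theorem ModNet.of_contDiff {g : E → F} (hg : ContDiff ℝ ∞ g) : ModNet fun _ => g where
  smooth := Eventually.of_forall fun _ => hg
  growth K hK k := by
    have hc : Continuous (iteratedFDeriv ℝ k g) :=
      hg.continuous_iteratedFDeriv (by exact_mod_cast le_top)
    obtain ⟨C, hC⟩ := hK.exists_bound_of_continuousOn hc.continuousOn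
    exact PolyBdd.of_le_const (C := C) (Eventually.of_forall fun ε x hx => hC x hx)

theorem ModNet.clm_comp (A : F →L[ℝ] G) {u : ℝ → E → F} (hu : ModNet u) :
    ModNet fun ε x => A (u ε x) where
  smooth := hu.smooth.mono fun ε h => A.contDiff.comp h
  growth K hK k := ((hu.growth K hK k).const_mul (norm_nonneg A)).mono (by
    filter_upwards [hu.smooth] with ε h x _
    exact A.norm_iteratedFDeriv_comp_left h.contDiffAt (by exact_mod_cast le_top))

theorem ModNet.add {u v : ℝ → E → F} (hu : ModNet u) (hv : ModNet v) :
    ModNet fun ε x => u ε x + v ε x where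
  smooth := by filter_upwards [hu.smooth, hv.smooth] with ε h1 h2 using h1.add h2
  growth K hK k := ((hu.growth K hK k).add (hv.growth K hK k)).mono (by
    filter_upwards [hu.smooth, hv.smooth] with ε h1 h2 x _
    have h3 : (fun x => u ε x + v ε x) = u ε + v ε := rfl
    rw [h3, iteratedFDeriv_add_apply (h1.of_le (by exact_mod_cast le_top)).contDiffAt
      (h2.of_le (by exact_mod_cast le_top)).contDiffAt]
    exact norm_add_le _ _)

theorem ModNet.neg {u : ℝ → E → F} (hu : ModNet u) : ModNet fun ε x => -u ε x :=
  hu.clm_comp (-ContinuousLinearMap.id ℝ F)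

theorem ModNet.sub {u v : ℝ → E → F} (hu : ModNet u) (hv : ModNet v) :
    ModNet fun ε x => u ε x - v ε x := by
  simpa only [sub_eq_add_neg] using hu.add hv.neg

theorem ModNet.prodMk {u : ℝ → E → F} {v : ℝ → E → G} (hu : ModNet u) (hv : ModNet v) :
    ModNet fun ε x => (u ε x, v ε x) :=
  ((hu.clm_comp (.inl ℝ F G)).add (hv.clm_comp (.inr ℝ F G))).congr
    (Eventually.of_forall fun ε => by ext x <;> simp)

theorem ModNet.bilin (B : F →L[ℝ] G →L[ℝ] H) {u : ℝ → E → F} {v : ℝ → E → G} (hu : ModNet u)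
    (hv : ModNet v) : ModNet fun ε x => B (u ε x) (v ε x) where
  smooth := by
    filter_upwards [hu.smooth, hv.smooth] with ε h1 h2
    exact B.isBoundedBilinearMap.contDiff.comp (h1.prodMk h2)
  growth K hK k := by
    have h := PolyBdd.sum (Finset.range (k + 1)) (φ := fun i ε x => ((k.choose i : ℝ) *
      ‖iteratedFDeriv ℝ i (u ε) x‖) * ‖iteratedFDeriv ℝ (k - i) (v ε) x‖) (K := K) fun i _ =>
        ((hu.growth K hK i).const_mul (Nat.cast_nonneg _)).mul (hv.growth K hK (k - i))
          (Eventually.of_forall fun _ _ _ => norm_nonneg _)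
    refine (h.const_mul (norm_nonneg B)).mono ?_
    filter_upwards [hu.smooth, hv.smooth] with ε h1 h2 x _
    exact B.norm_iteratedFDeriv_le_of_bilinear h1 h2 x (by exact_mod_cast le_top)

theorem ModNet.mul {u v : ℝ → E → ℝ} (hu : ModNet u) (hv : ModNet v) :
    ModNet fun ε x => u ε x * v ε x :=
  hu.bilin (ContinuousLinearMap.mul ℝ ℝ) hv

theorem ModNet.smul {u : ℝ → E → ℝ} {v : ℝ → E → F} (hu : ModNet u) (hv : ModNet v) :
    ModNet fun ε x => u ε x • v ε x :=
  hu.bilin (ContinuousLinearMap.lsmul ℝ ℝ) hv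

theorem ModNet.clm_apply {u : ℝ → E → F →L[ℝ] G} {v : ℝ → E → F} (hu : ModNet u) (hv : ModNet v) :
    ModNet fun ε x => u ε x (v ε x) :=
  hu.bilin (ContinuousLinearMap.id ℝ (F →L[ℝ] G)) hv

theorem ModNet.fderiv {u : ℝ → E → F} (hu : ModNet u) : ModNet fun ε => fderiv ℝ (u ε) where
  smooth := hu.smooth.mono fun ε h => h.fderiv_right (by simp)
  growth K hK k := (hu.growth K hK (k + 1)).mono (Eventually.of_forall fun ε x _ => by
    rw [norm_iteratedFDeriv_fderiv])

/-- By the Faà di Bruno estimate k!·C·Dᵏ with C = ε⁻ᴺ and D = ε⁻ᴹ. The bounds on g are required only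
along the net u, so that it applies even when u is not c-bounded. -/
theorem polyBdd_iteratedFDeriv_comp {u : ℝ → E → F} {g : ℝ → F → G} {t : Set F} (ht : IsOpen t)
    (hu : ∀ᶠ ε in 𝓝[>] (0 : ℝ), ContDiff ℝ ∞ (u ε))
    (hg : ∀ᶠ ε in 𝓝[>] (0 : ℝ), ContDiffOn ℝ ∞ (g ε) t ∧ range (u ε) ⊆ t) {K : Set E} {k : ℕ}
    (hKu : ∀ i ≤ k, PolyBdd K fun ε x => ‖iteratedFDeriv ℝ i (u ε) x‖)
    (hKg : ∀ i ≤ k, PolyBdd K fun ε x => ‖iteratedFDeriv ℝ i (g ε) (u ε x)‖) :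
    PolyBdd K fun ε x => ‖iteratedFDeriv ℝ k (fun x => g ε (u ε x)) x‖ := by
  obtain ⟨M, hM⟩ := exists_uniform_polyBdd (K := K)
    -- Orders above k, about which nothing is known, are set to zero, since the common exponent is
    -- extracted from a family indexed by all of ℕ.
    (φ := fun i ε x => if i ≤ k then ‖iteratedFDeriv ℝ i (u ε) x‖ else 0) (fun i => by
      by_cases hi : i ≤ k
      · simpa [hi] using hKu i hi
      · simpa [hi] using PolyBdd.of_le_const (C := 0) (by simp)) k
  obtain ⟨N, hN⟩ := exists_uniform_polyBdd (K := K)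
    (φ := fun i ε x => if i ≤ k then ‖iteratedFDeriv ℝ i (g ε) (u ε x)‖ else 0) (fun i => by
      by_cases hi : i ≤ k
      · simpa [hi] using hKg i hi
      · simpa [hi] using PolyBdd.of_le_const (C := 0) (by simp)) k
  refine PolyBdd.of_le (C := k.factorial) (N := N + M * k) ?_
  filter_upwards [hM, hN, hu, hg, eventually_mem_Ioc] with ε h1 h2 h3 h4 h5 x hx
  have h6 := norm_iteratedFDeriv_comp_le' h4.2 ht.uniqueDiffOn h4.1 h3 (n := k)
    (by exact_mod_cast le_top) x (C := (ε ^ N)⁻¹) (D := (ε ^ M)⁻¹) (fun i hi => by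
      rw [iteratedFDerivWithin_of_isOpen i ht (h4.2 (mem_range_self x))]
      simpa [hi] using h2 x hx i hi) (fun i hi1 hi => by
      refine le_trans (by simpa [hi] using h1 x hx i hi) ?_
      -- The estimate wants Dⁱ as the bound for order i; D suffices because D ≥ 1 and i ≥ 1.
      exact le_self_pow₀ (one_le_inv_pow h5 M) (by omega))
  refine h6.trans (le_of_eq ?_)
  rw [pow_add, pow_mul, mul_inv, inv_pow (ε ^ M) k, mul_assoc]

theorem ModNet.comp_of_polyBdd {u : ℝ → E → F} (hu : ModNet u) {g : ℝ → F → G} {t : Set F}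
    (ht : IsOpen t) (hg : ∀ᶠ ε in 𝓝[>] (0 : ℝ), ContDiffOn ℝ ∞ (g ε) t ∧ range (u ε) ⊆ t)
    (hKg : ∀ K : Set E, IsCompact K → ∀ k,
      PolyBdd K fun ε x => ‖iteratedFDeriv ℝ k (g ε) (u ε x)‖) :
    ModNet fun ε x => g ε (u ε x) where
  smooth := by
    filter_upwards [hu.smooth, hg] with ε h1 h2
    exact h2.1.comp_contDiff h1 fun x => h2.2 (mem_range_self x)
  growth K hK k := polyBdd_iteratedFDeriv_comp ht hu.smooth hg (fun i _ => hu.growth K hK i)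
    fun i _ => hKg K hK i

theorem ModNet.comp {u : ℝ → E → F} {g : ℝ → F → G} (hg : ModNet g) (hu : ModNet u)
    (hb : CBdd u) : ModNet fun ε x => g ε (u ε x) :=
  hu.comp_of_polyBdd isOpen_univ
    (hg.smooth.mono fun ε h => ⟨h.contDiffOn, subset_univ _⟩) fun K hK k => by
      obtain ⟨L, hL, hKL⟩ := hb K hK
      obtain ⟨N, hN⟩ := hg.growth L hL k
      refine ⟨N, ?_⟩
      filter_upwards [hKL, hN] with ε h1 h2 x hx using h2 _ (h1 hx)

theorem ModNet.comp_contDiff {u : E → F} {g : ℝ → F → G} (hg : ModNet g) (hu : ContDiff ℝ ∞ u) :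
    ModNet fun ε x => g ε (u x) :=
  hg.comp (ModNet.of_contDiff hu) (CBdd.of_continuous hu.continuous)

/-- A c-bounded net whose derivative is a moderate function of the net itself is moderate. -/
theorem ModNet.of_fderiv_eq_comp {u : ℝ → E → F} {Φ : ℝ → E × F → E →L[ℝ] F} (hΦ : ModNet Φ)
    (hs : ∀ᶠ ε in 𝓝[>] (0 : ℝ), ContDiff ℝ ∞ (u ε)) (hb : CBdd u)
    (h : ∀ᶠ ε in 𝓝[>] (0 : ℝ), ∀ x, _root_.fderiv ℝ (u ε) x = Φ ε (x, u ε x)) : ModNet u := by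
  refine ⟨hs, fun K hK k => ?_⟩
  have hb' : CBdd fun ε x => (x, u ε x) := (CBdd.of_continuous continuous_id).prodMk hb
  obtain ⟨L, hL, hKL⟩ := hb' K hK
  -- Order k + 1 of u is order k of x ↦ Φ(x, u x), which involves u only up to order k. Order 0 is
  -- c-boundedness.
  induction k using Nat.strong_induction_on with
  | _ k ih =>
    cases k with
    | zero =>
      obtain ⟨C, hC⟩ := hL.exists_bound_of_continuousOn (f := Prod.snd) continuous_snd.continuousOn
      refine PolyBdd.of_le_const (C := C) ?_
      filter_upwards [hKL] with ε h1 x hx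
      rw [norm_iteratedFDeriv_zero]
      exact hC _ (h1 hx)
    | succ k =>
      have hpair : ∀ i ≤ k, PolyBdd K fun ε x => ‖iteratedFDeriv ℝ i (fun x => (x, u ε x)) x‖ := by
        intro i hi
        have h1 := ((ModNet.of_contDiff (contDiff_id (𝕜 := ℝ) (E := E))).clm_comp
          (.inl ℝ E F)).growth K hK i
        have h2 := (ih i (by omega)).const_mul (norm_nonneg (ContinuousLinearMap.inr ℝ E F))
        refine (h1.add h2).mono ?_
        filter_upwards [hs] with ε hε x _
        have h3 : (fun x => (x, u ε x)) = (fun x => ContinuousLinearMap.inl ℝ E F (id x)) +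
            (ContinuousLinearMap.inr ℝ E F ∘ u ε) := by ext x <;> simp
        have h4 : ContDiff ℝ i (u ε) := hε.of_le (by exact_mod_cast le_top)
        have h6 : ContDiff ℝ i fun x => ContinuousLinearMap.inl ℝ E F (id x) := by fun_prop
        rw [h3, iteratedFDeriv_add_apply h6.contDiffAt
          ((ContinuousLinearMap.inr ℝ E F).contDiff.comp h4).contDiffAt]
        refine (norm_add_le _ _).trans (add_le_add le_rfl ?_)
        exact ContinuousLinearMap.norm_iteratedFDeriv_comp_left _ h4.contDiffAt le_rfl
      have h5 := polyBdd_iteratedFDeriv_comp (K := K) (k := k) (g := Φ) isOpen_univ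
        (hs.mono fun ε hε => contDiff_id.prodMk hε)
        (hΦ.smooth.mono fun ε h => ⟨h.contDiffOn, subset_univ _⟩) hpair fun i _ => by
          obtain ⟨N, hN⟩ := hΦ.growth L hL i
          refine ⟨N, ?_⟩
          filter_upwards [hKL, hN] with ε h1 h2 x hx using h2 _ (h1 hx)
      refine h5.mono ?_
      filter_upwards [h] with ε h6 x _
      rw [← norm_iteratedFDeriv_fderiv]
      have h7 : _root_.fderiv ℝ (u ε) = fun x => Φ ε (x, u ε x) := funext h6
      rw [h7]
      rfl

theorem ModNet.isModerate {u : ℝ → E → ℝ} (hu : ModNet u)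
    (hs : ∀ ε ∈ Ioc (0 : ℝ) 1, ContDiff ℝ ∞ (u ε)) (U : Opens E) : IsModerate U u where
  smooth ε hε := (hs ε hε).contDiffOn
  growth K hK _ k := by
    obtain ⟨N, hN⟩ := hu.growth K hK k
    exact ⟨N, 1, by simpa using hN⟩

theorem IsModerate.modNet {u : ℝ → E → ℝ} (hu : IsModerate ⊤ u) : ModNet u where
  smooth := by
    filter_upwards [eventually_mem_Ioc] with ε hε
    simpa [contDiffOn_univ] using hu.smooth ε hε
  growth K hK k := by
    obtain ⟨N, C, h⟩ := hu.growth K hK (by simp) k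
    exact PolyBdd.of_le h

end ModNet

/-! ### Moderateness of integrals with variable upper limit. -/

section Integral

variable {E F : Type} [NormedAddCommGroup E] [NormedSpace ℝ E] [NormedAddCommGroup F]
  [NormedSpace ℝ F]

theorem ModNet.curryUnit {g : ℝ → C(E × ℝ, F)} (hg : ModNet fun ε => ⇑(g ε)) :
    ModNet fun ε => curryUnit (g ε) where
  smooth := hg.smooth.mono fun ε h => contDiff_curryUnit _ h
  growth K hK k := by
    obtain ⟨N, hN⟩ := hg.growth (K ×ˢ Icc 0 1) (hK.prod isCompact_Icc) k
    refine ⟨N, ?_⟩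
    filter_upwards [hN, hg.smooth, eventually_mem_Ioc] with ε h1 h2 h3 x hx
    have := pow_pos h3.1 N
    exact norm_iteratedFDeriv_curryUnit_le _ h2 k x (by positivity) fun q hq => h1 _ ⟨hx, hq⟩

variable [CompleteSpace F]

theorem integral_eq_curryUnit (g : C(E × ℝ, F)) (p : E) :
    ∫ q in (0 : ℝ)..1, g (p, q) = volterra F (PPWave.curryUnit g p) 1 :=
  (volterra_apply_of_eqOn _ (fun q => g (p, q)) (fun _ => rfl) 1).symm

theorem intervalIntegral_eq_smul (g : ℝ → F) (a U : ℝ) :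
    ∫ s in a..U, g s = (U - a) • ∫ q in (0 : ℝ)..1, g (a + q * (U - a)) := by
  have := intervalIntegral.smul_integral_comp_add_mul (a := 0) (b := 1) g (U - a) a
  simp only [mul_zero, add_zero, mul_one, add_sub_cancel] at this
  rw [← this]
  simp only [mul_comm]

/-- The substitution s = a + q(U - a) turns the upper limit into a parameter of the integrand; what
remains is a continuous linear functional of the curried integrand. -/
theorem ModNet.integral_right {g : ℝ → E × ℝ → F} (hg : ModNet g) (a : ℝ) :
    ModNet fun ε (z : E × ℝ) => ∫ s in a..z.2, g ε (z.1, s) := by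
  obtain ⟨g', hg'⟩ : ∃ g' : ℝ → C((E × ℝ) × ℝ, F), ∀ᶠ ε in 𝓝[>] (0 : ℝ),
      ⇑(g' ε) = fun z : (E × ℝ) × ℝ => g ε (z.1.1, a + z.2 * (z.1.2 - a)) := by
    classical
    refine ⟨fun ε => if h : ContDiff ℝ ∞ (g ε) then
      ⟨fun z : (E × ℝ) × ℝ => g ε (z.1.1, a + z.2 * (z.1.2 - a)),
        h.continuous.comp (by fun_prop)⟩ else 0, ?_⟩
    filter_upwards [hg.smooth] with ε h
    simp [h]
  have h1 : ModNet fun ε => ⇑(g' ε) :=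
    (hg.comp_contDiff (u := fun z : (E × ℝ) × ℝ => (z.1.1, a + z.2 * (z.1.2 - a)))
      (by fun_prop)).congr hg'
  have h2 := (h1.curryUnit.clm_comp (volterra F)).clm_comp
    (ContinuousMap.evalCLM ℝ (M := F) (1 : unitInterval))
  have h3 : ModNet fun (_ : ℝ) (z : E × ℝ) => z.2 - a := ModNet.of_contDiff (by fun_prop)
  refine (h3.smul h2).congr ?_
  filter_upwards [hg'] with ε h
  funext z
  rw [intervalIntegral_eq_smul]
  congr 1
  refine Eq.trans ?_ (integral_eq_curryUnit (g' ε) z)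
  rw [h]

end Integral

/-! ### The solution as a smooth function of the integral operator. -/

section SolutionOperator

variable {P B : Type*} [NormedAddCommGroup P] [NormedSpace ℝ P] [CompleteSpace P]
  [NormedAddCommGroup B] [NormedSpace ℝ B] [CompleteSpace B]

/-- The equation `y = L (N (X, y))` has a solution depending smoothly on the parameter `X` and on
the operator `L`, as long as `L` is small. -/
theorem exists_solution_operator {N : P × B → B} (hN : ContDiff ℝ ∞ N) {M : ℝ} (hM0 : 0 ≤ M)
    (hM : ∀ X y z, ‖N (X, y) - N (X, z)‖ ≤ M * ‖y - z‖) :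
    ∃ Y : P × (B →L[ℝ] B) → B, ContDiffOn ℝ ∞ Y {q | ‖q.2‖ * M < 1} ∧
      ∀ q, ‖q.2‖ * M < 1 → Y q = q.2 (N (q.1, Y q)) ∧ ∀ y, y = q.2 (N (q.1, y)) → y = Y q := by
  have hO : IsOpen {q : P × (B →L[ℝ] B) | ‖q.2‖ * M < 1} :=
    isOpen_lt (by fun_prop) continuous_const
  set Ψ : (P × (B →L[ℝ] B)) × B → B := fun z => z.1.2 (N (z.1.1, z.2)) with hΨdef
  have hΨ : ContDiff ℝ ∞ Ψ := by
    have h1 : ContDiff ℝ ∞ fun z : (P × (B →L[ℝ] B)) × B => N (z.1.1, z.2) :=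
      hN.comp (by fun_prop)
    have h2 : ContDiff ℝ ∞ fun z : (P × (B →L[ℝ] B)) × B => z.1.2 := by fun_prop
    exact h2.clm_apply h1
  have hlip : ∀ q : P × (B →L[ℝ] B), ∀ y z,
      ‖Ψ (q, y) - Ψ (q, z)‖ ≤ ‖q.2‖ * M * ‖y - z‖ := by
    intro q y z
    simp only [hΨdef, ← map_sub]
    refine (q.2.le_opNorm _).trans ?_
    rw [mul_assoc]
    exact mul_le_mul_of_nonneg_left (hM _ _ _) (norm_nonneg _)
  have hex : ∀ q : P × (B →L[ℝ] B), ∃ y, ‖q.2‖ * M < 1 → Ψ (q, y) = y := by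
    intro q
    by_cases h : ‖q.2‖ * M < 1
    · obtain ⟨y, hy⟩ := exists_fixedPoint_of_norm_sub_le (fun y => Ψ (q, y))
        (mul_nonneg (norm_nonneg _) hM0) h (hlip q)
      exact ⟨y, fun _ => hy⟩
    · exact ⟨0, fun h' => absurd h' h⟩
  choose Y hY using hex
  refine ⟨Y, fun q hq => ?_, fun q hq => ⟨(hY q hq).symm, fun y hy => ?_⟩⟩
  · exact (contDiffAt_fixedPoint hΨ hO (fun q hq => ⟨‖q.2‖ * M,
      mul_nonneg (norm_nonneg _) hM0, hq, hlip q⟩) hY hq).contDiffWithinAt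
  · exact fixedPoint_unique_of_norm_sub_le (fun y => Ψ (q, y)) hq (hlip q) hy.symm (hY q hq)

theorem norm_solution_le {y v : B} {L : B →L[ℝ] B} (h : y = L v) {M₀ : ℝ} (hv : ‖v‖ ≤ M₀) :
    ‖y‖ ≤ ‖L‖ * M₀ := by
  rw [h]
  exact (L.le_opNorm _).trans (mul_le_mul_of_nonneg_left hv (norm_nonneg _))

/-- Since y - y' = L(v - v'), one gets ‖y - y'‖ ≤ ½(r + ‖y - y'‖), and the last term is absorbed on
the left. -/
theorem norm_solution_sub_le {y y' v v' : B} {L : B →L[ℝ] B} (h : y = L v) (h' : y' = L v')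
    {M r : ℝ} (hv : ‖v - v'‖ ≤ M * (r + ‖y - y'‖)) (hr : 0 ≤ r) (hL : ‖L‖ * M ≤ 1 / 2) :
    ‖y - y'‖ ≤ r := by
  have h1 : ‖y - y'‖ ≤ 1 / 2 * (r + ‖y - y'‖) :=
    calc ‖y - y'‖ = ‖L (v - v')‖ := by rw [map_sub, ← h, ← h']
      _ ≤ ‖L‖ * (M * (r + ‖y - y'‖)) :=
        (L.le_opNorm _).trans (mul_le_mul_of_nonneg_left hv (norm_nonneg _))
      _ ≤ 1 / 2 * (r + ‖y - y'‖) := by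
        rw [← mul_assoc]
        exact mul_le_mul_of_nonneg_right hL (by positivity)
  linarith

end SolutionOperator

/-! ### The nonlinearity on the window. -/

section WindowMap

variable {E : Type} [NormedAddCommGroup E] [NormedSpace ℝ E]

/-- The map `(X, y) ↦ F ∘ (X + y)`. -/
noncomputable def superposeShift (F : C(E, E)) (z : E × C(unitInterval, E)) : C(unitInterval, E) :=
  superpose unitInterval F (constFun unitInterval E z.1 + z.2)

theorem contDiff_superposeShift (F : C(E, E)) (hF : ContDiff ℝ ∞ F) :
    ContDiff ℝ ∞ (superposeShift F) :=
  (contDiff_superpose F hF).comp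
    (((constFun unitInterval E).contDiff.comp contDiff_fst).add contDiff_snd)

theorem norm_superposeShift_sub_le {F : C(E, E)} {M : ℝ} (hM : ∀ y z, ‖F y - F z‖ ≤ M * ‖y - z‖)
    (hM0 : 0 ≤ M) (X X' : E) (y z : C(unitInterval, E)) :
    ‖superposeShift F (X, y) - superposeShift F (X', z)‖ ≤ M * (‖X - X'‖ + ‖y - z‖) := by
  rw [ContinuousMap.norm_le _ (by positivity)]
  intro s
  refine (hM _ _).trans ?_
  gcongr
  simp only [ContinuousMap.add_apply, constFun_apply]
  rw [add_sub_add_comm]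
  refine (norm_add_le _ _).trans ?_
  gcongr
  exact (y - z).norm_coe_le_norm s

end WindowMap

/-! ### Derivative bounds near the zero operator. -/

section Tube

variable {E G H : Type*} [NormedAddCommGroup E] [NormedSpace ℝ E] [NormedAddCommGroup G]
  [NormedSpace ℝ G] [NormedAddCommGroup H] [NormedSpace ℝ H]

/-- A tube argument around K × {y}: only K has to be compact. This matters because G will be an
infinite-dimensional operator space, whose balls are not compact. -/
theorem eventually_norm_iteratedFDeriv_le {Y : E × G → H} {O : Set (E × G)} (hO : IsOpen O)
    (hY : ContDiffOn ℝ ∞ Y O) {K : Set E} (hK : IsCompact K) {y : G} (hKO : ∀ X ∈ K, (X, y) ∈ O)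
    (k : ℕ) : ∃ C : ℝ, ∀ᶠ z in 𝓝 y, ∀ X ∈ K, ‖iteratedFDeriv ℝ k Y (X, z)‖ ≤ C := by
  have hc : ContinuousOn (fun q => ‖iteratedFDeriv ℝ k Y q‖) O := by
    have h1 := (hY.continuousOn_iteratedFDerivWithin (m := k) (by exact_mod_cast le_top)
      hO.uniqueDiffOn).norm
    refine h1.congr fun q hq => ?_
    simp only [iteratedFDerivWithin_of_isOpen k hO hq]
  obtain ⟨C, hC⟩ := hK.exists_bound_of_continuousOn
    (f := fun X => ‖iteratedFDeriv ℝ k Y (X, y)‖)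
    (hc.comp (f := fun X => (X, y)) (by fun_prop) hKO)
  refine ⟨C + 1, hK.eventually_forall_of_forall_eventually fun X hX => ?_⟩
  have h2 : ∀ᶠ q in 𝓝 (X, y), ‖iteratedFDeriv ℝ k Y q‖ < C + 1 := by
    refine (hc.continuousAt (hO.mem_nhds (hKO X hX))).eventually_lt_const ?_
    have := hC X hX
    rw [norm_norm] at this
    linarith
  have h3 : Tendsto (fun q : G × E => (q.2, q.1)) (𝓝 (y, X)) (𝓝 (X, y)) :=
    (continuous_swap.tendsto (y, X))
  exact (h3.eventually h2).mono fun _ h => h.le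

/-- Y does not depend on ε and `L ε` tends to 0 uniformly, so eventually the derivatives of Y are
evaluated in a fixed tube around K × {0}, where they are bounded. All growth comes from L. -/
theorem modNet_comp_of_tendsto_zero {Y : E × G → H} {M : ℝ}
    (hY : ContDiffOn ℝ ∞ Y {q | ‖q.2‖ * M < 1}) {L : ℝ → ℝ → G} (hL : ModNet L) {c : ℝ → ℝ}
    (hc : Tendsto c (𝓝[>] 0) (𝓝 0)) (hLc : ∀ᶠ ε in 𝓝[>] (0 : ℝ), ∀ s, ‖L ε s‖ ≤ c ε)
    (hLM : ∀ᶠ ε in 𝓝[>] (0 : ℝ), ∀ s, ‖L ε s‖ * M < 1) :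
    ModNet fun ε (z : E × ℝ) => Y (z.1, L ε z.2) := by
  have hO : IsOpen {q : E × G | ‖q.2‖ * M < 1} := isOpen_lt (by fun_prop) continuous_const
  have h1 : ModNet fun ε (z : E × ℝ) => (z.1, L ε z.2) :=
    (ModNet.of_contDiff contDiff_fst).prodMk (hL.comp_contDiff contDiff_snd)
  refine h1.comp_of_polyBdd (g := fun _ => Y) hO ?_ fun K hK k => ?_
  · filter_upwards [hLM] with ε h
    refine ⟨hY, ?_⟩
    rintro _ ⟨z, rfl⟩
    exact h z.2
  · obtain ⟨C', hC'⟩ := eventually_norm_iteratedFDeriv_le hO hY (hK.image continuous_fst)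
      (y := 0) (fun X _ => by simp) k
    obtain ⟨r, hr, hball⟩ := Metric.eventually_nhds_iff_ball.1 hC'
    refine PolyBdd.of_le_const (C := C') ?_
    filter_upwards [hLc, hc.eventually_lt_const hr] with ε h3 h4 z hz
    refine hball _ ?_ z.1 (mem_image_of_mem _ hz)
    rw [mem_ball_zero_iff]
    exact (h3 z.2).trans_lt h4

end Tube

/-! ### The integral operator on a shrinking time window. -/

section Window

variable {E : Type} [NormedAddCommGroup E] [NormedSpace ℝ E] [CompleteSpace E]

/-- The coefficient of the equation on the time window `[-ε, σ s]`, rescaled to `[0, 1]`. -/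
def windowCoeff (ε : ℝ) (d σ : C(ℝ, ℝ)) : C(ℝ × ℝ, ℝ) :=
  ⟨fun z => (ε + σ z.1) ^ 2 * d (-ε + (ε + σ z.1) * z.2), by fun_prop⟩

/-- The integral operator of the equation on the time window `[-ε, σ s]`, rescaled to `[0, 1]`. -/
noncomputable def windowOp (E : Type) [NormedAddCommGroup E] [NormedSpace ℝ E] [CompleteSpace E]
    (ε : ℝ) (d σ : C(ℝ, ℝ)) (s : ℝ) : C(unitInterval, E) →L[ℝ] C(unitInterval, E) :=
  secondOrderOp E (curryUnit (windowCoeff ε d σ) s)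

theorem abs_intervalIntegral_le_integral_abs {d : ℝ → ℝ} (hd : Continuous d)
    (hc : HasCompactSupport d) (a b : ℝ) : |∫ s in a..b, (|d s|)| ≤ ∫ s, |d s| := by
  have hi : MeasureTheory.Integrable (fun s => |d s|) :=
    hd.abs.integrable_of_hasCompactSupport hc.norm
  rw [intervalIntegral.abs_integral_eq_abs_integral_uIoc, abs_of_nonneg
    (MeasureTheory.integral_nonneg fun _ => abs_nonneg _)]
  exact MeasureTheory.setIntegral_le_integral hi (Eventually.of_forall fun _ => abs_nonneg _)

/-- One of the two factors ε + σ s in the coefficient is the Jacobian that turns the integral into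
one of |d| in the original time; the other is at most 3ε in absolute value. -/
theorem norm_windowOp_le {ε : ℝ} (hε : 0 < ε) {d σ : C(ℝ, ℝ)} (hc : HasCompactSupport d)
    (hσ : ∀ s, |σ s| ≤ 2 * ε) (s : ℝ) :
    ‖windowOp E ε d σ s‖ ≤ 3 * ε * ∫ r, |d r| := by
  refine (norm_secondOrderOp_le _
    (fun q => (ε + σ s) ^ 2 * d (-ε + (ε + σ s) * q)) (fun q => rfl)).trans ?_
  have h1 := intervalIntegral.smul_integral_comp_add_mul (a := 0) (b := 1) (fun r => |d r|)
    (ε + σ s) (-ε)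
  have h2 : ∀ q : ℝ, |(ε + σ s) ^ 2 * d (-ε + (ε + σ s) * q)|
      = (ε + σ s) * ((ε + σ s) * |d (-ε + (ε + σ s) * q)|) := fun q => by
    rw [abs_mul, abs_of_nonneg (sq_nonneg _)]; ring
  simp only [h2, intervalIntegral.integral_const_mul]
  rw [← smul_eq_mul (ε + σ s) (∫ _ in _.._, _), h1]
  refine (le_abs_self _).trans ?_
  rw [abs_mul]
  refine mul_le_mul ?_ (abs_intervalIntegral_le_integral_abs d.continuous hc _ _) (abs_nonneg _)
    (by positivity)
  have := hσ s
  rw [abs_le] at this ⊢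
  constructor <;> linarith

/-- Rescaling of the unit interval. -/
def rescale (l : unitInterval) (h : C(unitInterval, E)) : C(unitInterval, E) :=
  ⟨fun r => h (l * r), by fun_prop⟩

theorem rescale_volterra (l : unitInterval) (h : C(unitInterval, E)) :
    rescale l (volterra E h) = (l : ℝ) • volterra E (rescale l h) := by
  ext r
  change volterra E h (l * r) = (l : ℝ) • volterra E (rescale l h) r
  rw [volterra_apply_of_eqOn (rescale l h) (fun q => IccExtend zero_le_one h (l * q)) (fun q => by
    have : (l : ℝ) * q ∈ Icc (0 : ℝ) 1 := (l * q).2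
    simp only [IccExtend_of_mem _ _ this]; rfl), volterra_apply,
    intervalIntegral.smul_integral_comp_mul_left]
  simp

/-- Each of the two integrations contributes one factor l. -/
theorem rescale_secondOrderOp (l : unitInterval) (d : C(unitInterval, ℝ)) (h : C(unitInterval, E)) :
    rescale l (secondOrderOp E d h)
      = secondOrderOp E ((l : ℝ) ^ 2 • rescale l d) (rescale l h) := by
  rw [secondOrderOp_apply, rescale_volterra, rescale_volterra, map_smul, smul_smul, map_smul,
    ← pow_two]
  rfl

variable {F : C(E, E)} {ε : ℝ} {d σ : C(ℝ, ℝ)}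

/-- The solution on the window `[-ε, s]` is the restriction of the solution on `[-ε, ε]`. -/
theorem rescale_isSolution (hε : 0 < ε) (hσ : ∀ s ∈ Icc (-ε) ε, σ s = s) {X : E}
    {y : C(unitInterval, E)}
    (hy : y = windowOp E ε d σ ε (superposeShift F (X, y)))
    {s : ℝ} (hs : s ∈ Icc (-ε) ε) (l : unitInterval) (hl : 2 * ε * l = ε + s) :
    rescale l y = windowOp E ε d σ s (superposeShift F (X, rescale l y)) := by
  conv_lhs => rw [hy]
  rw [windowOp, rescale_secondOrderOp, windowOp]
  congr 2
  ext q
  have h1 : ε ∈ Icc (-ε) ε := ⟨by linarith, le_rfl⟩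
  simp only [rescale, windowCoeff, curryUnit_apply, ContinuousMap.smul_apply, ContinuousMap.coe_mk,
    hσ s hs, hσ ε h1, smul_eq_mul]
  rw [← hl]
  have : (((l * q : unitInterval)) : ℝ) = l * q := rfl
  rw [this]
  ring_nf

end Window

/-! ### Return from the rescaled window to the original time. -/

section Trajectory

variable {E : Type} [NormedAddCommGroup E] [NormedSpace ℝ E] [CompleteSpace E]
  {F : C(E, E)} {ε : ℝ} {d σ : C(ℝ, ℝ)}

theorem integral_eq_zero_of_forall_le {a : ℝ → E} {c : ℝ} (ha : ∀ s ≤ c, a s = 0) {b u : ℝ}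
    (hb : b ≤ c) (hu : u ≤ c) : ∫ s in b..u, a s = 0 := by
  have : ∫ s in b..u, a s = ∫ s in b..u, (0 : E) := by
    refine intervalIntegral.integral_congr fun s hs => ha s ?_
    exact hs.2.trans (max_le hb hu)
  rw [this]
  simp

theorem integral_eq_of_forall_le {a : ℝ → E} (hac : Continuous a) {c : ℝ}
    (ha : ∀ s ≤ c, a s = 0) {b : ℝ} (hb : b ≤ c) (u : ℝ) :
    ∫ s in b..u, a s = ∫ s in c..u, a s := by
  rw [← intervalIntegral.integral_add_adjacent_intervals (hac.intervalIntegrable b c)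
    (hac.intervalIntegrable c u), integral_eq_zero_of_forall_le ha hb le_rfl, zero_add]

/-- A solution of the rescaled integral equation on the unit interval is, in the original time
variable, a solution of the second order equation. -/
theorem window_eq_integral (hε : 0 < ε) (hε1 : ε ≤ 1) (hσ : ∀ s ∈ Icc (-ε) ε, σ s = s)
    (hd : ∀ s ≤ -ε, d s = 0) {X : E} {y : C(unitInterval, E)}
    (hy : y = windowOp E ε d σ ε (superposeShift F (X, y))) {w : ℝ → E} (hwc : Continuous w)
    (hw : ∀ s ∈ Icc (-ε) ε, ∀ l : unitInterval, 2 * ε * l = ε + s → w s = X + y l)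
    {s : ℝ} (hs : s ∈ Icc (-ε) ε) :
    X + ∫ r in (-1)..s, ∫ t in (-1)..r, d t • F (w t) = w s := by
  have hac : Continuous fun t => d t • F (w t) := by fun_prop
  have ha : ∀ t ≤ -ε, d t • F (w t) = 0 := fun t ht => by simp [hd t ht]
  have hpc : Continuous fun r => ∫ t in (-1)..r, d t • F (w t) :=
    intervalIntegral.continuous_primitive (fun _ _ => hac.intervalIntegrable _ _) _
  have hp : ∀ r ≤ -ε, ∫ t in (-1)..r, d t • F (w t) = 0 := fun r hr =>
    integral_eq_zero_of_forall_le ha (by linarith) hr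
  rw [integral_eq_of_forall_le hpc hp (by linarith)]
  have hmem : ∀ q : unitInterval, -ε + 2 * ε * q ∈ Icc (-ε) ε := fun q =>
    ⟨by nlinarith [q.2.1], by nlinarith [q.2.2]⟩
  -- Of the factor (2ε)² in the coefficient, one 2ε is the Jacobian of the inner integral; the other
  -- is left for the outer one.
  have h1 : ∀ q : unitInterval,
      volterra E (pointwiseBilin (ContinuousLinearMap.lsmul ℝ ℝ)
        (curryUnit (windowCoeff ε d σ) ε) (superposeShift F (X, y))) q
      = (fun r : ℝ => (2 * ε) • ∫ t in (-1)..(-ε + 2 * ε * r), d t • F (w t)) q := by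
    intro q
    rw [volterra_apply_of_eqOn _
      (fun r => (2 * ε) • (2 * ε) • (d (-ε + 2 * ε * r) • F (w (-ε + 2 * ε * r))))]
    · simp only [intervalIntegral.integral_smul]
      rw [intervalIntegral.smul_integral_comp_add_mul (fun t => d t • F (w t)),
        mul_zero, add_zero, ← integral_eq_of_forall_le hac ha (b := -1) (by linarith)]
    · intro r
      have h2 := hw _ (hmem r) r (by ring)
      simp only [pointwiseBilin_apply, curryUnit_apply, windowCoeff, ContinuousMap.coe_mk,
        ContinuousLinearMap.lsmul_apply, superposeShift, superpose_apply, ContinuousMap.add_apply,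
        constFun_apply]
      rw [h2, hσ ε ⟨by linarith, le_rfl⟩, smul_smul, smul_smul]
      ring_nf
  obtain ⟨l, hl⟩ : ∃ l : unitInterval, 2 * ε * l = ε + s := by
    refine ⟨⟨(ε + s) / (2 * ε), ?_, ?_⟩, ?_⟩
    · exact div_nonneg (by linarith [hs.1]) (by linarith)
    · rw [div_le_one (by linarith)]; linarith [hs.2]
    · simp only; field_simp
  rw [hw s hs l hl]
  congr 1
  conv_rhs => rw [hy]
  rw [windowOp, secondOrderOp_apply, volterra_apply_of_eqOn _
    (fun r : ℝ => (2 * ε) • ∫ t in (-1)..(-ε + 2 * ε * r), d t • F (w t)) h1]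
  simp only [intervalIntegral.integral_smul]
  rw [intervalIntegral.smul_integral_comp_add_mul (fun r => ∫ t in (-1)..r, d t • F (w t))]
  congr 1
  · ring
  · linarith

end Trajectory

/-! ### A smooth cutoff of the window's right end. -/

section Clamp

/-- Scaled by ε, this keeps the right end of the window in [-2ε, 2ε] for every real s, without
moving it when s ∈ [-ε, ε], so the integral operator stays small for all s. -/
theorem exists_clamp : ∃ ψ : ℝ → ℝ, ContDiff ℝ ∞ ψ ∧ HasCompactSupport ψ ∧ (∀ r, |ψ r| ≤ 2) ∧
    ∀ r ∈ Icc (-1 : ℝ) 1, ψ r = r := by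
  let χ : ContDiffBump (0 : ℝ) := ⟨1, 2, one_pos, one_lt_two⟩
  refine ⟨fun r => χ r * r, χ.contDiff.mul contDiff_id, χ.hasCompactSupport.mul_right, ?_, ?_⟩
  · intro r
    by_cases h : r ∈ Metric.ball (0 : ℝ) 2
    · rw [abs_mul, abs_of_nonneg χ.nonneg]
      have h1 : |r| ≤ 2 := by simpa using (Metric.mem_ball.1 h).le
      have := χ.le_one (x := r)
      nlinarith [abs_nonneg r, χ.nonneg (x := r)]
    · have : χ r = 0 := by
        rw [← Function.notMem_support, χ.support_eq]; exact h
      simp [this]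
  · intro r hr
    have : χ r = 1 := χ.one_of_mem_closedBall (by simpa [abs_le] using hr)
    simp [this]

theorem modNet_const {E F : Type*} [NormedAddCommGroup E] [NormedSpace ℝ E] [NormedAddCommGroup F]
    [NormedSpace ℝ F] {c : ℝ → F} {N : ℕ} (hc : ∀ᶠ ε in 𝓝[>] (0 : ℝ), ‖c ε‖ ≤ (ε ^ N)⁻¹) :
    ModNet fun ε (_ : E) => c ε where
  smooth := Eventually.of_forall fun _ => contDiff_const
  growth K _ k := by
    refine ⟨N, ?_⟩
    filter_upwards [hc, eventually_mem_Ioc] with ε h1 h2 x _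
    rcases Nat.eq_zero_or_pos k with rfl | hk
    · simpa [norm_iteratedFDeriv_zero] using h1
    · rw [iteratedFDeriv_const_of_ne hk.ne']
      have := pow_pos h2.1 N
      simp only [Pi.zero_apply, norm_zero]
      positivity

/-- The inner net ε⁻¹s is not c-bounded, so `ModNet.comp` does not apply; instead, compact support
bounds every derivative of ψ on all of ℝ. -/
theorem modNet_clamp {ψ : ℝ → ℝ} (hψ : ContDiff ℝ ∞ ψ) (hc : HasCompactSupport ψ) :
    ModNet fun ε s => ε * ψ (ε⁻¹ * s) := by
  have h1 : ModNet fun (ε : ℝ) (_ : ℝ) => ε := modNet_const (N := 0) (by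
    filter_upwards [eventually_mem_Ioc] with ε h
    simpa [abs_of_pos h.1] using h.2)
  have h2 : ModNet fun (ε : ℝ) (_ : ℝ) => ε⁻¹ := modNet_const (N := 1) (by
    filter_upwards [eventually_mem_Ioc] with ε h
    simp [abs_of_pos h.1])
  have h3 : ModNet fun (ε : ℝ) (s : ℝ) => ε⁻¹ * s := h2.mul (ModNet.of_contDiff contDiff_id)
  refine h1.mul (h3.comp_of_polyBdd (g := fun _ => ψ) isOpen_univ
    (Eventually.of_forall fun ε => ⟨hψ.contDiffOn, subset_univ _⟩) fun K _ k => ?_)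
  have h4 : Continuous (iteratedFDeriv ℝ k ψ) :=
    hψ.continuous_iteratedFDeriv (by exact_mod_cast le_top)
  obtain ⟨C, hC⟩ := h4.bounded_above_of_compact_support (hc.iteratedFDeriv k)
  exact PolyBdd.of_le_const (C := C) (Eventually.of_forall fun ε x _ => hC _)

end Clamp

/-! ### Moderate flows for bounded, globally Lipschitz vector fields. -/

section Flow

variable {E : Type} [NormedAddCommGroup E] [NormedSpace ℝ E]

/-- `(x, p)` consists of positions and velocities of global solutions of `x'' = d F(x)`, with
vanishing velocity before the time `-ε`; velocities are bounded and Lipschitz continuous in the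
initial position with constant `A`. -/
structure IsFlow (F : E → E) (d : ℝ → ℝ) (ε A : ℝ) (x p : E × ℝ → E) : Prop where
  smooth_x : ContDiff ℝ ∞ x
  smooth_p : ContDiff ℝ ∞ p
  hasDerivAt_x : ∀ X u, HasDerivAt (fun s => x (X, s)) (p (X, u)) u
  hasDerivAt_p : ∀ X u, HasDerivAt (fun s => p (X, s)) (d u • F (x (X, u))) u
  x_of_le : ∀ X, ∀ u ≤ -ε, x (X, u) = X
  p_of_le : ∀ X, ∀ u ≤ -ε, p (X, u) = 0
  norm_p_le : ∀ z, ‖p z‖ ≤ A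
  norm_p_sub_le : ∀ X X' u, ‖p (X, u) - p (X', u)‖ ≤ A * ‖X - X'‖

theorem norm_integral_smul_le [CompleteSpace E] {d : ℝ → ℝ} (hd : Continuous d)
    (hc : HasCompactSupport d) {g : ℝ → E} {B : ℝ} (hB : 0 ≤ B) (hg : ∀ s, ‖g s‖ ≤ B) (a b : ℝ) :
    ‖∫ s in a..b, d s • g s‖ ≤ (∫ s, |d s|) * B := by
  refine (intervalIntegral.norm_integral_le_abs_of_norm_le (g := fun s => |d s| * B)
    (Eventually.of_forall fun s => ?_)
    ((hd.abs.mul continuous_const).intervalIntegrable _ _)).trans ?_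
  · rw [norm_smul, Real.norm_eq_abs]
    exact mul_le_mul_of_nonneg_left (hg s) (abs_nonneg _)
  · rw [intervalIntegral.integral_mul_const, abs_mul, abs_of_nonneg hB]
    exact mul_le_mul_of_nonneg_right (abs_intervalIntegral_le_integral_abs hd hc a b) hB

theorem IsStrictDeltaNet.hasCompactSupport {δ : ℝ → ℝ → ℝ} (hδ : IsStrictDeltaNet δ) {ε : ℝ}
    (hε : ε ∈ Ioc (0 : ℝ) 1) : HasCompactSupport (δ ε) :=
  isCompact_Icc.of_isClosed_subset (isClosed_tsupport _) (hδ.support ε hε)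

/-- The endpoints ±ε are included by continuity; this gives zero data at -1 even when ε = 1. -/
theorem IsStrictDeltaNet.eq_zero {δ : ℝ → ℝ → ℝ} (hδ : IsStrictDeltaNet δ) {ε : ℝ}
    (hε : ε ∈ Ioc (0 : ℝ) 1) {s : ℝ} (hs : s ∉ Ioo (-ε) ε) : δ ε s = 0 := by
  have hcl : IsClosed {s | δ ε s = 0} :=
    isClosed_eq (hδ.smooth ε hε).continuous continuous_const
  have h1 : ∀ s ∉ Icc (-ε) ε, δ ε s = 0 := fun s hs =>
    image_eq_zero_of_notMem_tsupport fun h => hs (hδ.support ε hε h)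
  have h2 : Iio (-ε) ⊆ {s | δ ε s = 0} := fun s hs => h1 s fun h => absurd h.1 (not_le.2 hs)
  have h3 : Ioi ε ⊆ {s | δ ε s = 0} := fun s hs => h1 s fun h => absurd h.2 (not_le.2 hs)
  rcases le_or_gt s (-ε) with h | h
  · have := hcl.closure_subset_iff.2 h2
    rw [closure_Iio] at this
    exact this h
  · have := hcl.closure_subset_iff.2 h3
    rw [closure_Ioi] at this
    exact this (not_lt.1 fun h' => hs ⟨h, h'⟩)

variable [FiniteDimensional ℝ E]

/-- Moderate nets solving the equation on the time window `[-ε, ε]`. -/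
theorem exists_modNet_window (F : C(E, E)) (hF : ContDiff ℝ ∞ F) {M M₀ : ℝ} (hM0 : 0 ≤ M)
    (hM : ∀ y z, ‖F y - F z‖ ≤ M * ‖y - z‖) (hM₀ : ∀ y, ‖F y‖ ≤ M₀) {δ : ℝ → ℝ → ℝ}
    (hδ : IsStrictDeltaNet δ) (hδm : ModNet δ) :
    ∃ w : ℝ → E × ℝ → E, ModNet w ∧ CBdd w ∧ ∀ᶠ ε in 𝓝[>] (0 : ℝ),
      (∀ X X' s, ‖w ε (X, s) - w ε (X', s)‖ ≤ 2 * ‖X - X'‖) ∧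
      ∀ X, ∀ s ∈ Icc (-ε) ε,
        X + ∫ r in (-1)..s, ∫ t in (-1)..r, δ ε t • F (w ε (X, t)) = w ε (X, s) := by
  have : CompleteSpace E := FiniteDimensional.complete ℝ E
  have : ProperSpace E := FiniteDimensional.proper ℝ E
  have hM₀0 : 0 ≤ M₀ := (norm_nonneg _).trans (hM₀ 0)
  obtain ⟨ψ, hψ, hψc, hψ2, hψ1⟩ := exists_clamp
  obtain ⟨C, hC0, hC⟩ := hδ.integral_abs_le
  obtain ⟨D, hD⟩ : ∃ D : ℝ → C(ℝ, ℝ), ∀ ε ∈ Ioc (0 : ℝ) 1, ⇑(D ε) = δ ε := by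
    classical
    refine ⟨fun ε => if h : ε ∈ Ioc (0 : ℝ) 1 then ⟨δ ε, (hδ.smooth ε h).continuous⟩ else 0,
      fun ε h => by simp only [dif_pos h]; rfl⟩
  have hDm : ModNet fun ε => ⇑(D ε) := hδm.congr (by
    filter_upwards [eventually_mem_Ioc] with ε h using hD ε h)
  let σ : ℝ → C(ℝ, ℝ) := fun ε => ⟨fun s => ε * ψ (ε⁻¹ * s), by
    have := hψ.continuous
    fun_prop⟩
  have hσm : ModNet fun ε => ⇑(σ ε) := modNet_clamp hψ hψc
  have hσ2 : ∀ ε ∈ Ioc (0 : ℝ) 1, ∀ s, |σ ε s| ≤ 2 * ε := fun ε hε s => by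
    simp only [σ, ContinuousMap.coe_mk, abs_mul, abs_of_pos hε.1]
    rw [mul_comm]
    exact mul_le_mul_of_nonneg_right (hψ2 _) hε.1.le
  have hσ1 : ∀ ε ∈ Ioc (0 : ℝ) 1, ∀ s ∈ Icc (-ε) ε, σ ε s = s := fun ε hε s hs => by
    have hne := hε.1.ne'
    simp only [σ, ContinuousMap.coe_mk]
    rw [hψ1 _ ⟨?_, ?_⟩]
    · field_simp
    · rw [inv_mul_eq_div, le_div_iff₀ hε.1]; linarith [hs.1]
    · rw [inv_mul_eq_div, div_le_iff₀ hε.1]; linarith [hs.2]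
  obtain ⟨Y, hYs, hY⟩ := exists_solution_operator (contDiff_superposeShift F hF) hM0
    (fun X y z => by simpa using norm_superposeShift_sub_le hM hM0 X X y z)
  have hid : ModNet fun (ε : ℝ) (_ : ℝ × ℝ) => ε := modNet_const (N := 0) (by
    filter_upwards [eventually_mem_Ioc] with ε h
    simpa [abs_of_pos h.1] using h.2)
  have hcoeff : ModNet fun ε => ⇑(windowCoeff ε (D ε) (σ ε)) := by
    have h1 : ModNet fun ε (z : ℝ × ℝ) => ε + σ ε z.1 := hid.add (hσm.comp_contDiff contDiff_fst)
    have h2 : ModNet fun ε (z : ℝ × ℝ) => -ε + (ε + σ ε z.1) * z.2 :=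
      hid.neg.add (h1.mul (ModNet.of_contDiff contDiff_snd))
    have h3 : CBdd fun ε (z : ℝ × ℝ) => -ε + (ε + σ ε z.1) * z.2 := CBdd.of_norm_le fun K hK => by
      obtain ⟨R, hR⟩ := hK.exists_bound_of_continuousOn (f := Prod.snd) continuous_snd.continuousOn
      refine ⟨1 + 3 * R, ?_⟩
      filter_upwards [eventually_mem_Ioc] with ε hε z hz
      refine (norm_add_le _ _).trans ?_
      rw [norm_neg, Real.norm_of_nonneg hε.1.le, norm_mul]
      refine add_le_add hε.2 (mul_le_mul ?_ (hR z hz) (norm_nonneg _) (by norm_num))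
      refine (norm_add_le _ _).trans ?_
      rw [Real.norm_of_nonneg hε.1.le, Real.norm_eq_abs]
      linarith [hσ2 ε hε z.1, hε.2]
    have h4 := (h1.mul h1).mul (hDm.comp h2 h3)
    refine h4.congr (Eventually.of_forall fun ε => funext fun z => ?_)
    simp [windowCoeff, pow_two]
  have hop : ModNet fun ε => windowOp E ε (D ε) (σ ε) :=
    ModNet.clm_comp (F := C(unitInterval, ℝ)) (G := C(unitInterval, E) →L[ℝ] C(unitInterval, E))
      (secondOrderOp E) hcoeff.curryUnit
  have hC3 : ∀ᶠ ε in 𝓝[>] (0 : ℝ), ∀ s, ‖windowOp E ε (D ε) (σ ε) s‖ ≤ 3 * ε * C := by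
    filter_upwards [hC, eventually_mem_Ioc] with ε h1 h2 s
    have h3 : HasCompactSupport (D ε) := by rw [hD ε h2]; exact hδ.hasCompactSupport h2
    refine (norm_windowOp_le h2.1 h3 (hσ2 ε h2) s).trans ?_
    rw [hD ε h2]
    exact mul_le_mul_of_nonneg_left h1 (by linarith [h2.1])
  have hlim : ∀ c : ℝ, Tendsto (fun ε : ℝ => 3 * ε * C * c) (𝓝[>] 0) (𝓝 0) := fun c => by
    have h1 : Continuous fun ε : ℝ => 3 * ε * C * c := by fun_prop
    simpa using (h1.tendsto 0).mono_left nhdsWithin_le_nhds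
  have hhalf : ∀ᶠ ε in 𝓝[>] (0 : ℝ), ∀ s, ‖windowOp E ε (D ε) (σ ε) s‖ * M ≤ 1 / 2 := by
    filter_upwards [hC3, (hlim M).eventually_lt_const (u := 1 / 2) (by norm_num)] with ε h1 h2 s
    exact (mul_le_mul_of_nonneg_right (h1 s) hM0).trans h2.le
  -- The position at time s is read off at the right end of the window [-ε, s]. Thus time, like ε,
  -- enters only through the operator, and moderateness in s follows from that of `windowOp`.
  let w : ℝ → E × ℝ → E := fun ε z => z.1 + Y (z.1, windowOp E ε (D ε) (σ ε) z.2) 1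
  have hwm : ModNet w := by
    have h2 : ModNet fun ε (z : E × ℝ) => Y (z.1, windowOp E ε (D ε) (σ ε) z.2) :=
      modNet_comp_of_tendsto_zero hYs hop (by simpa using hlim 1) hC3
        (hhalf.mono fun ε h s => (h s).trans_lt (by norm_num))
    exact (ModNet.of_contDiff contDiff_fst).add
      (h2.clm_comp (ContinuousMap.evalCLM ℝ (M := E) (1 : unitInterval)))
  have hYle : ∀ᶠ ε in 𝓝[>] (0 : ℝ), ∀ z, ‖w ε z - z.1‖ ≤ 3 * ε * C * M₀ := by
    filter_upwards [hC3, hhalf] with ε h1 h2 z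
    simp only [w, add_sub_cancel_left]
    have h3 := (h2 z.2).trans_lt (by norm_num : (1 / 2 : ℝ) < 1)
    have h1' := h1 z.2
    set L := windowOp E ε (D ε) (σ ε) z.2 with hL
    have h4 := (hY (z.1, L) h3).1
    have h5 : ‖superposeShift F (z.1, Y (z.1, L))‖ ≤ M₀ := by
      rw [ContinuousMap.norm_le _ hM₀0]
      exact fun s => hM₀ _
    exact (ContinuousMap.norm_coe_le_norm _ _).trans ((norm_solution_le h4 h5).trans
      (mul_le_mul_of_nonneg_right h1' hM₀0))
  have hYlip : ∀ᶠ ε in 𝓝[>] (0 : ℝ), ∀ X X' s, ‖w ε (X, s) - w ε (X', s)‖ ≤ 2 * ‖X - X'‖ := by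
    filter_upwards [hhalf] with ε h2 X X' s
    have h3 := (h2 s).trans_lt (by norm_num : (1 / 2 : ℝ) < 1)
    set L := windowOp E ε (D ε) (σ ε) s with hL
    have h4 : ‖Y (X, L) - Y (X', L)‖ ≤ ‖X - X'‖ :=
      norm_solution_sub_le (hY (X, L) h3).1 (hY (X', L) h3).1
        (norm_superposeShift_sub_le hM hM0 X X' _ _) (norm_nonneg _) (h2 s)
    have h5 : w ε (X, s) - w ε (X', s) = (X - X') + (Y (X, L) - Y (X', L)) 1 := by
      simp only [w, ContinuousMap.sub_apply]
      abel
    rw [h5]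
    refine (norm_add_le _ _).trans ?_
    have := (Y (X, L) - Y (X', L)).norm_coe_le_norm 1
    linarith
  have hwb : CBdd w := CBdd.of_norm_le fun K hK => by
    obtain ⟨R, hR⟩ := hK.exists_bound_of_continuousOn (f := Prod.fst) continuous_fst.continuousOn
    refine ⟨R + 1, ?_⟩
    filter_upwards [hYle, (hlim M₀).eventually_lt_const one_pos] with ε h1 h2 z hz
    have h3 := norm_add_le z.1 (w ε z - z.1)
    rw [add_sub_cancel] at h3
    linarith [h1 z, hR z hz]
  refine ⟨w, hwm, hwb, ?_⟩
  filter_upwards [hwm.smooth, hYlip, hhalf, eventually_mem_Ioc] with ε hws hlip hh hε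
  refine ⟨hlip, fun X s hs => ?_⟩
  have hlt : ‖windowOp E ε (D ε) (σ ε) ε‖ * M < 1 := (hh ε).trans_lt (by norm_num)
  have h1 := window_eq_integral (F := F) (X := X) (d := D ε) (σ := σ ε) hε.1 hε.2 (hσ1 ε hε)
    (fun s hs => by
      rw [hD ε hε]; exact hδ.eq_zero hε fun h => absurd h.1 (not_lt.2 hs))
    (hY (X, windowOp E ε (D ε) (σ ε) ε) hlt).1 (w := fun s => w ε (X, s))
    (hws.continuous.comp (by fun_prop)) (fun s hs l hl => by
      have h2 := rescale_isSolution hε.1 (hσ1 ε hε)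
        (hY (X, windowOp E ε (D ε) (σ ε) ε) hlt).1 hs l hl
      -- Uniqueness on the shorter window: the rescaled solution is the one defining w at time s.
      have h3 := (hY (X, windowOp E ε (D ε) (σ ε) s) ((hh s).trans_lt (by norm_num))).2 _ h2
      simp only [w, ← h3]
      simp [rescale]) hs
  rw [hD ε hε] at h1
  exact h1

/-- Existence of a moderate net of flows for a globally Lipschitz and bounded profile. -/
theorem exists_modNet_flow (F : C(E, E)) (hF : ContDiff ℝ ∞ F) {M M₀ : ℝ} (hM0 : 0 ≤ M)
    (hM : ∀ y z, ‖F y - F z‖ ≤ M * ‖y - z‖) (hM₀ : ∀ y, ‖F y‖ ≤ M₀) {δ : ℝ → ℝ → ℝ}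
    (hδ : IsStrictDeltaNet δ) (hδm : ModNet δ) :
    ∃ (x p : ℝ → E × ℝ → E) (A : ℝ), 0 ≤ A ∧ ModNet x ∧ ModNet p ∧
      ∀ᶠ ε in 𝓝[>] (0 : ℝ), IsFlow F (δ ε) ε A (x ε) (p ε) := by
  have : CompleteSpace E := FiniteDimensional.complete ℝ E
  have hM₀0 : 0 ≤ M₀ := (norm_nonneg _).trans (hM₀ 0)
  obtain ⟨C, hC0, hC⟩ := hδ.integral_abs_le
  obtain ⟨w, hwm, hwb, hw⟩ := exists_modNet_window F hF hM0 hM hM₀ hδ hδm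
  -- Outside the window w need not follow the trajectory, but there δ vanishes; so this is the true
  -- acceleration at all times, and two integrations give the global flow.
  let a : ℝ → E × ℝ → E := fun ε z => δ ε z.2 • F (w ε z)
  have ham : ModNet a :=
    (hδm.comp_contDiff contDiff_snd).smul ((ModNet.of_contDiff hF).comp hwm hwb)
  let p : ℝ → E × ℝ → E := fun ε z => ∫ s in (-1)..z.2, a ε (z.1, s)
  have hpm : ModNet p := ham.integral_right (-1)
  let x : ℝ → E × ℝ → E := fun ε z => z.1 + ∫ s in (-1)..z.2, p ε (z.1, s)
  have hxm : ModNet x := (ModNet.of_contDiff contDiff_fst).add (hpm.integral_right (-1))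
  -- The first summand bounds the velocity, the second its Lipschitz constant; the 2 is the
  -- Lipschitz constant of w in X.
  refine ⟨x, p, C * M₀ + C * (M * 2), by positivity, hxm, hpm, ?_⟩
  filter_upwards [ham.smooth, hw, hpm.smooth, hxm.smooth, hC,
    eventually_mem_Ioc] with ε has ⟨hlip, hw⟩ hps hxs hCε hε
  have hcs := hδ.hasCompactSupport hε
  have hdc := (hδ.smooth ε hε).continuous
  have hac : ∀ X, Continuous fun s => a ε (X, s) := fun X => has.continuous.comp (by fun_prop)
  have hpc : ∀ X, Continuous fun s => p ε (X, s) := fun X => hps.continuous.comp (by fun_prop)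
  have ha0 : ∀ X, ∀ s ≤ -ε, a ε (X, s) = 0 := fun X s hs => by
    simp only [a, hδ.eq_zero hε (fun h => absurd h.1 (not_lt.2 hs)), zero_smul]
  have hp0 : ∀ X, ∀ s ≤ -ε, p ε (X, s) = 0 := fun X s hs =>
    integral_eq_zero_of_forall_le (ha0 X) (by linarith [hε.2]) hs
  have hxw : ∀ X, ∀ s ∈ Icc (-ε) ε, x ε (X, s) = w ε (X, s) := hw
  refine ⟨hxs, hps, fun X u => ?_, fun X u => ?_, fun X u hu => ?_, hp0, fun z => ?_,
    fun X X' u => ?_⟩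
  · exact ((hpc X).integral_hasStrictDerivAt (-1) u).hasDerivAt.const_add X
  · have h1 := ((hac X).integral_hasStrictDerivAt (-1) u).hasDerivAt
    have h2 : δ ε u • F (x ε (X, u)) = a ε (X, u) := by
      by_cases hu : u ∈ Icc (-ε) ε
      · simp only [a, hxw X u hu]
      · simp only [a, hδ.eq_zero hε fun h => hu (Ioo_subset_Icc_self h), zero_smul]
    rw [h2]
    exact h1
  · simp only [x]
    rw [integral_eq_zero_of_forall_le (hp0 X) (by linarith [hε.2]) hu, add_zero]
  · have h1 := norm_integral_smul_le hdc hcs hM₀0 (g := fun s => F (w ε (z.1, s)))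
      (fun s => hM₀ _) (-1) z.2
    have h2 := mul_le_mul_of_nonneg_right hCε hM₀0
    have h3 : 0 ≤ C * (M * 2) := by positivity
    linarith [h1]
  · have h1 := norm_integral_smul_le hdc hcs (B := M * (2 * ‖X - X'‖)) (by positivity)
      (g := fun s => F (w ε (X, s)) - F (w ε (X', s)))
      (fun s => (hM _ _).trans (mul_le_mul_of_nonneg_left (hlip X X' s) hM0)) (-1) u
    have h2 : p ε (X, u) - p ε (X', u)
        = ∫ s in (-1)..u, δ ε s • (F (w ε (X, s)) - F (w ε (X', s))) := by
      simp only [smul_sub]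
      exact (intervalIntegral.integral_sub ((hac X).intervalIntegrable _ _)
        ((hac X').intervalIntegrable _ _)).symm
    rw [h2]
    have h3 := mul_le_mul_of_nonneg_right hCε (by positivity : 0 ≤ M * (2 * ‖X - X'‖))
    have h4 : 0 ≤ C * M₀ * ‖X - X'‖ := by positivity
    nlinarith [h1]

end Flow

/-! ### Displacement estimates for flows. -/

section FlowEstimates

variable {E : Type} [NormedAddCommGroup E] [NormedSpace ℝ E] {F : E → E} {d : ℝ → ℝ} {ε A : ℝ}
  {x p : E × ℝ → E}

theorem norm_sub_le_of_hasDerivAt_of_const {y y' : ℝ → E} {c B : ℝ} {y₀ : E}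
    (hy : ∀ u, HasDerivAt y (y' u) u) (h0 : ∀ u ≤ c, y u = y₀) (hB : ∀ u, ‖y' u‖ ≤ B) (u : ℝ) :
    ‖y u - y₀‖ ≤ B * max (u - c) 0 := by
  rcases le_total u c with h | h
  · rw [h0 u h, max_eq_right (by linarith)]
    simp
  · rw [max_eq_left (by linarith), ← h0 c le_rfl]
    exact norm_image_sub_le_of_norm_deriv_le_segment' (f' := y')
      (fun s _ => (hy s).hasDerivWithinAt) (fun s _ => hB s) u ⟨h, le_rfl⟩

theorem IsFlow.norm_x_sub_le (h : IsFlow F d ε A x p) (X : E) (u : ℝ) :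
    ‖x (X, u) - X‖ ≤ A * max (u + ε) 0 := by
  simpa using norm_sub_le_of_hasDerivAt_of_const (h.hasDerivAt_x X) (h.x_of_le X)
    (fun u => h.norm_p_le (X, u)) u

/-- This makes the position map a contractive perturbation of the identity up to a small positive
time, and exactly the identity for u ≤ -ε, however negative. -/
theorem IsFlow.norm_displacement_sub_le (h : IsFlow F d ε A x p) (X X' : E) (u : ℝ) :
    ‖(x (X, u) - X) - (x (X', u) - X')‖ ≤ A * ‖X - X'‖ * max (u + ε) 0 := by
  have h1 := norm_sub_le_of_hasDerivAt_of_const (c := -ε) (y₀ := X - X')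
    (fun u => (h.hasDerivAt_x X u).sub (h.hasDerivAt_x X' u))
    (fun u hu => by simp only [Pi.sub_apply, h.x_of_le X u hu, h.x_of_le X' u hu])
    (h.norm_p_sub_le X X') u
  rw [sub_neg_eq_add] at h1
  refine le_trans (le_of_eq ?_) h1
  congr 1
  simp only [Pi.sub_apply]
  abel

end FlowEstimates

/-! ### The geodesic equations with compactly supported profile. -/

section Geodesic

/-- The vector field `½ ∇f`. -/
noncomputable def halfGrad (f : (Fin 2 → ℝ) → ℝ) (y : Fin 2 → ℝ) : Fin 2 → ℝ := fun i =>
  1 / 2 * pderiv i f y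

theorem contDiff_pderiv {f : (Fin 2 → ℝ) → ℝ} (hf : ContDiff ℝ ∞ f) (i : Fin 2) :
    ContDiff ℝ ∞ (pderiv i f) :=
  (hf.fderiv_right (m := ∞) (by simp)).clm_apply contDiff_const

theorem contDiff_halfGrad {f : (Fin 2 → ℝ) → ℝ} (hf : ContDiff ℝ ∞ f) :
    ContDiff ℝ ∞ (halfGrad f) :=
  contDiff_pi.2 fun i => contDiff_const.mul (contDiff_pderiv hf i)

theorem hasCompactSupport_halfGrad {f : (Fin 2 → ℝ) → ℝ} (hc : HasCompactSupport f) :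
    HasCompactSupport (halfGrad f) := by
  refine (hc.fderiv (𝕜 := ℝ)).mono fun y hy => ?_
  contrapose! hy
  have h1 : fderiv ℝ f y = 0 := by simpa using hy
  simp only [Function.mem_support, not_not]
  funext i
  simp [halfGrad, pderiv, h1]

theorem fderiv_eq_sum_pderiv (f : (Fin 2 → ℝ) → ℝ) (y q : Fin 2 → ℝ) :
    fderiv ℝ f y q = ∑ i : Fin 2, pderiv i f y * q i := by
  have h : q = ∑ i : Fin 2, q i • (Pi.single i 1 : Fin 2 → ℝ) := by
    funext j
    fin_cases j <;> simp [Fin.sum_univ_two]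
  conv_lhs => rw [h, map_sum]
  simp only [map_smul, smul_eq_mul, pderiv]
  exact Finset.sum_congr rfl fun i _ => mul_comm _ _

/-- Moderate nets of global solutions of the geodesic equations, for a compactly supported
profile. -/
theorem exists_modNet_geodesic {f : (Fin 2 → ℝ) → ℝ} (hf : ContDiff ℝ ∞ f)
    (hc : HasCompactSupport f) {δ : ℝ → ℝ → ℝ} (hδ : IsStrictDeltaNet δ) (hδm : ModNet δ) :
    ∃ (x p : ℝ → (Fin 2 → ℝ) × ℝ → Fin 2 → ℝ) (w : ℝ → (Fin 2 → ℝ) × ℝ → ℝ) (A : ℝ), 0 ≤ A ∧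
      ModNet x ∧ ModNet w ∧ CBdd x ∧
      ∀ᶠ ε in 𝓝[>] (0 : ℝ), IsFlow (halfGrad f) (δ ε) ε A (x ε) (p ε) ∧ ContDiff ℝ ∞ (w ε) ∧
        (∀ z, |w ε z| ≤ A * (1 + |z.2|)) ∧
        ∀ X V, SolvesGeodesic f (δ ε) X V (fun u => x ε (X, u)) (fun u => V + w ε (X, u)) := by
  have hF := contDiff_halfGrad hf
  have hFc := hasCompactSupport_halfGrad hc
  obtain ⟨M, hM⟩ := hF.lipschitzWith_of_hasCompactSupport hFc (by simp)
  obtain ⟨M₀, hM₀⟩ := hF.continuous.bounded_above_of_compact_support hFc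
  obtain ⟨B, hB⟩ := hf.continuous.bounded_above_of_compact_support hc
  obtain ⟨B', hB'⟩ := (hf.continuous_fderiv (by simp)).bounded_above_of_compact_support
    (hc.fderiv (𝕜 := ℝ))
  have hB0 : 0 ≤ B := (norm_nonneg _).trans (hB 0)
  have hB'0 : 0 ≤ B' := (norm_nonneg _).trans (hB' 0)
  obtain ⟨x, p, A, hA, hx, hp, hflow⟩ := exists_modNet_flow ⟨halfGrad f, hF.continuous⟩ hF M.2
    (fun y z => by simpa [dist_eq_norm] using hM.dist_le_mul y z) hM₀ hδ hδm
  have hxb : CBdd x := CBdd.of_norm_le fun K hK => by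
    obtain ⟨R, hR⟩ := hK.exists_bound_of_continuousOn (f := id) continuous_id.continuousOn
    refine ⟨R + A * (R + 1), ?_⟩
    filter_upwards [hflow, eventually_mem_Ioc] with ε h hε z hz
    have h1 : ‖z‖ ≤ R := hR z hz
    have h2 := norm_add_le z.1 (x ε z - z.1)
    rw [add_sub_cancel] at h2
    have h3 := h.norm_x_sub_le z.1 z.2
    have h4 : max (z.2 + ε) 0 ≤ R + 1 := by
      have h5 := (le_abs_self z.2).trans ((norm_snd_le z).trans h1)
      have h6 := (norm_nonneg z).trans h1
      exact max_le (by linarith [hε.2]) (by linarith)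
    have := mul_le_mul_of_nonneg_left h4 hA
    linarith [(norm_fst_le z).trans h1]
  obtain ⟨C, hC0, hC⟩ := hδ.integral_abs_le
  -- Since f(x)δ̇ + 2 df(x)(ẋ)δ = (f(x)δ)˙ + df(x)(ẋ)δ, the first integral of the v-equation is b +
  -- q, with b = f(x)δ and q a primitive of g. Thus δ̇, which has no uniform L¹ bound, disappears.
  let g : ℝ → (Fin 2 → ℝ) × ℝ → ℝ := fun ε z => δ ε z.2 * fderiv ℝ f (x ε z) (p ε z)
  have hδz : ModNet fun ε (z : (Fin 2 → ℝ) × ℝ) => δ ε z.2 := hδm.comp_contDiff contDiff_snd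
  have hg : ModNet g := hδz.mul
    (((ModNet.of_contDiff (hf.fderiv_right (m := ∞) (by simp))).comp hx hxb).clm_apply hp)
  let q : ℝ → (Fin 2 → ℝ) × ℝ → ℝ := fun ε z => ∫ s in (-1)..z.2, g ε (z.1, s)
  have hq : ModNet q := hg.integral_right (-1)
  let b : ℝ → (Fin 2 → ℝ) × ℝ → ℝ := fun ε z => δ ε z.2 * f (x ε z)
  have hb : ModNet b := hδz.mul ((ModNet.of_contDiff hf).comp hx hxb)
  let w : ℝ → (Fin 2 → ℝ) × ℝ → ℝ := fun ε z => ∫ s in (-1)..z.2, (b ε (z.1, s) + q ε (z.1, s))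
  have hbq : ModNet fun ε z => b ε z + q ε z := hb.add hq
  have hw : ModNet w := hbq.integral_right (-1)
  have hD0 : 0 ≤ C * B + C * (B' * A) := by positivity
  -- One constant serves the flow and w: `C * B` bounds the integral of b, and `C * (B' * A)` bounds
  -- q, whose integral grows linearly in time.
  refine ⟨x, p, w, A + (C * B + C * (B' * A)), by positivity, hx, hw, hxb, ?_⟩
  filter_upwards [hflow, hC, hg.smooth, hq.smooth, hb.smooth, hw.smooth, hx.smooth,
    hδm.smooth, Ioo_mem_nhdsGT one_pos] with ε h hCε hgs hqs hbs hws hxs hδs hε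
  have hε1 : ε ∈ Ioc (0 : ℝ) 1 := Ioo_subset_Ioc_self hε
  have hcs := hδ.hasCompactSupport hε1
  have hqc : ∀ X, Continuous fun s => q ε (X, s) := fun X => hqs.continuous.comp (by fun_prop)
  have hbc : ∀ X, Continuous fun s => b ε (X, s) := fun X => hbs.continuous.comp (by fun_prop)
  have hgc : ∀ X, Continuous fun s => g ε (X, s) := fun X => hgs.continuous.comp (by fun_prop)
  have hwd : ∀ X u, HasDerivAt (fun s => w ε (X, s)) (b ε (X, u) + q ε (X, u)) u := fun X u =>
    (((hbc X).add (hqc X)).integral_hasStrictDerivAt (-1) u).hasDerivAt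
  have hqd : ∀ X u, HasDerivAt (fun s => q ε (X, s)) (g ε (X, u)) u := fun X u =>
    ((hgc X).integral_hasStrictDerivAt (-1) u).hasDerivAt
  have hfx : ∀ X u, HasDerivAt (fun s => f (x ε (X, s))) (fderiv ℝ f (x ε (X, u)) (p ε (X, u))) u :=
    fun X u => ((hf.differentiable (by simp)) _).hasFDerivAt.comp_hasDerivAt u (h.hasDerivAt_x X u)
  have hxi : ∀ X u (i : Fin 2), HasDerivAt (fun s => x ε (X, s) i) (p ε (X, u) i) u :=
    fun X u i => hasDerivAt_pi.1 (h.hasDerivAt_x X u) i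
  have hpi : ∀ X u (i : Fin 2), HasDerivAt (fun s => p ε (X, s) i)
      (δ ε u • halfGrad f (x ε (X, u)) i) u :=
    fun X u i => hasDerivAt_pi.1 (h.hasDerivAt_p X u) i
  have hm1 : (-1 : ℝ) ≤ -ε := by linarith [hε.2]
  have hδ1 : δ ε (-1) = 0 := hδ.eq_zero hε1 fun h' => absurd h'.1 (not_lt.2 hm1)
  refine ⟨⟨h.smooth_x, h.smooth_p, h.hasDerivAt_x, h.hasDerivAt_p, h.x_of_le, h.p_of_le,
    fun z => (h.norm_p_le z).trans (by linarith), fun X X' u => (h.norm_p_sub_le X X' u).trans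
      (mul_le_mul_of_nonneg_right (by linarith) (norm_nonneg _))⟩, hws, fun z => ?_,
    fun X V => ?_⟩
  · have h1 : ∀ X u, ‖q ε (X, u)‖ ≤ C * (B' * A) := fun X u => by
      refine (norm_integral_smul_le hδs.continuous hcs (B := B' * A) (by positivity)
        (g := fun s => fderiv ℝ f (x ε (X, s)) (p ε (X, s))) (fun s => ?_) (-1) u).trans
          (mul_le_mul_of_nonneg_right hCε (by positivity))
      exact (ContinuousLinearMap.le_opNorm _ _).trans
        (mul_le_mul (hB' _) (h.norm_p_le _) (norm_nonneg _) hB'0)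
    have h2 : ‖∫ s in (-1)..z.2, q ε (z.1, s)‖ ≤ C * (B' * A) * (1 + |z.2|) := by
      refine (intervalIntegral.norm_integral_le_of_norm_le_const fun s _ => h1 z.1 s).trans ?_
      refine mul_le_mul_of_nonneg_left ?_ (by positivity)
      rw [sub_neg_eq_add, add_comm]
      exact (abs_add_le _ _).trans (by simp)
    have h3 : ‖∫ s in (-1)..z.2, b ε (z.1, s)‖ ≤ C * B :=
      (norm_integral_smul_le hδs.continuous hcs hB0 (g := fun s => f (x ε (z.1, s)))
        (fun s => hB _) (-1) z.2).trans (mul_le_mul_of_nonneg_right hCε hB0)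
    have h4 : w ε z = (∫ s in (-1)..z.2, b ε (z.1, s)) + ∫ s in (-1)..z.2, q ε (z.1, s) :=
      intervalIntegral.integral_add ((hbc _).intervalIntegrable _ _)
        ((hqc _).intervalIntegrable _ _)
    rw [h4, ← Real.norm_eq_abs]
    refine (norm_add_le _ _).trans ?_
    have h5 : 0 ≤ C * B * |z.2| := by positivity
    have h6 : 0 ≤ A * (1 + |z.2|) := by positivity
    linarith
  · have hd1 : ∀ i, deriv (fun s => x ε (X, s) i) = fun s => p ε (X, s) i := fun i =>
      funext fun u => (hxi X u i).deriv
    have hd2 : deriv (fun u => V + w ε (X, u)) = fun u => b ε (X, u) + q ε (X, u) :=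
      funext fun u => ((hwd X u).const_add V).deriv
    refine ⟨hxs.comp (by fun_prop), contDiff_const.add (hws.comp (by fun_prop)), fun i u => ?_,
      fun u => ?_, h.x_of_le X _ hm1, fun i => ?_, ?_, ?_⟩
    · rw [hd1, (hpi X u i).deriv]
      simp only [halfGrad, smul_eq_mul]
      ring
    · have hδd := (hδs.differentiable (by simp) u).hasDerivAt
      have hbd : HasDerivAt (fun s => b ε (X, s) + q ε (X, s))
          (deriv (δ ε) u * f (x ε (X, u)) + δ ε u * fderiv ℝ f (x ε (X, u)) (p ε (X, u))
            + g ε (X, u)) u := (hδd.mul (hfx X u)).add (hqd X u)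
      rw [hd2, hbd.deriv]
      simp only [g, hd1, fderiv_eq_sum_pderiv, ← Finset.sum_mul]
      ring
    · rw [hd1]
      simp only [h.p_of_le X _ hm1, Pi.zero_apply]
    · simp [w]
    · rw [hd2]
      simp [b, q, hδ1]

end Geodesic

/-! ### Uniqueness of geodesics and locality in the profile. -/

section Uniqueness

/-- F is only locally Lipschitz, but on a bounded time interval both solutions stay in a common
ball, where F is Lipschitz; the velocity needs no bound, as it enters the first order system
linearly. -/
theorem secondOrder_unique {E : Type*} [NormedAddCommGroup E] [NormedSpace ℝ E]
    [FiniteDimensional ℝ E] {F : E → E} (hF : ContDiff ℝ ∞ F) {d : ℝ → ℝ} (hd : Continuous d)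
    {ξ η ξ' η' : ℝ → E} (h1 : ∀ u, HasDerivAt ξ (η u) u) (h2 : ∀ u, HasDerivAt η (d u • F (ξ u)) u)
    (h1' : ∀ u, HasDerivAt ξ' (η' u) u) (h2' : ∀ u, HasDerivAt η' (d u • F (ξ' u)) u) {t₀ : ℝ}
    (h3 : ξ t₀ = ξ' t₀) (h4 : η t₀ = η' t₀) : ξ = ξ' := by
  have : ProperSpace E := FiniteDimensional.proper ℝ E
  funext u
  set T : ℝ := |u - t₀| + 1 with hT
  have hcξ : Continuous ξ := continuous_iff_continuousAt.2 fun u => (h1 u).continuousAt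
  have hcξ' : Continuous ξ' := continuous_iff_continuousAt.2 fun u => (h1' u).continuousAt
  obtain ⟨R₁, hR₁⟩ := (isCompact_Icc (a := t₀ - T) (b := t₀ + T)).exists_bound_of_continuousOn
    hcξ.continuousOn
  obtain ⟨R₂, hR₂⟩ := (isCompact_Icc (a := t₀ - T) (b := t₀ + T)).exists_bound_of_continuousOn
    hcξ'.continuousOn
  obtain ⟨D, hD⟩ := (isCompact_Icc (a := t₀ - T) (b := t₀ + T)).exists_bound_of_continuousOn
    hd.continuousOn
  obtain ⟨M, hM⟩ := (isCompact_closedBall (0 : E) (max R₁ R₂)).exists_bound_of_continuousOn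
    (hF.continuous_fderiv (by simp)).continuousOn
  have hlip : ∀ y ∈ Metric.closedBall (0 : E) (max R₁ R₂), ∀ z ∈ Metric.closedBall (0 : E)
      (max R₁ R₂), ‖F y - F z‖ ≤ M * ‖y - z‖ := fun y hy z hz =>
    Convex.norm_image_sub_le_of_norm_fderiv_le (fun x _ => hF.differentiable (by simp) x) hM
      (convex_closedBall _ _) hz hy
  have ht₀ : t₀ ∈ Icc (t₀ - T) (t₀ + T) := by
    constructor <;> linarith [abs_nonneg (u - t₀)]
  have hD0 : 0 ≤ D := (norm_nonneg _).trans (hD t₀ ht₀)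
  have hM0 : 0 ≤ M := (norm_nonneg _).trans (hM (ξ t₀) (by
    simpa using Or.inl (hR₁ t₀ ht₀)))
  have key := ODE_solution_unique_of_mem_Ioo (E := E × E) (a := t₀ - T) (b := t₀ + T) (t₀ := t₀)
    (v := fun t z => (z.2, d t • F z.1)) (s := fun _ => Metric.closedBall 0 (max R₁ R₂) ×ˢ univ)
    (K := ⟨max 1 (D * M), le_max_of_le_left zero_le_one⟩) (f := fun t => (ξ t, η t))
    (g := fun t => (ξ' t, η' t)) ?_ (by constructor <;> linarith [abs_nonneg (u - t₀)])
    (fun t ht => ⟨(h1 t).prodMk (h2 t), ⟨by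
      simpa using Or.inl (hR₁ t (Ioo_subset_Icc_self ht)), mem_univ _⟩⟩)
    (fun t ht => ⟨(h1' t).prodMk (h2' t), ⟨by
      simpa using Or.inr (hR₂ t (Ioo_subset_Icc_self ht)), mem_univ _⟩⟩)
    (by simp only [h3, h4])
  · have := key (x := u) (by
      have := abs_le.1 (le_refl |u - t₀|)
      constructor <;> linarith)
    exact congrArg Prod.fst this
  · intro t ht
    refine LipschitzOnWith.of_dist_le_mul fun y hy z hz => ?_
    rw [dist_eq_norm, dist_eq_norm]
    change _ ≤ max 1 (D * M) * ‖y - z‖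
    rw [Prod.mk_sub_mk, Prod.norm_def]
    refine max_le ?_ ?_
    · simp only
      rw [← Prod.snd_sub]
      exact (norm_snd_le _).trans (le_mul_of_one_le_left (norm_nonneg _) (le_max_left _ _))
    · simp only
      rw [← smul_sub, norm_smul]
      calc ‖d t‖ * ‖F y.1 - F z.1‖ ≤ D * (M * ‖(y - z).1‖) :=
            mul_le_mul (hD t (Ioo_subset_Icc_self ht)) (hlip _ hy.1 _ hz.1) (norm_nonneg _) hD0
        _ ≤ D * (M * ‖y - z‖) := by gcongr; exact norm_fst_le _
        _ ≤ max 1 (D * M) * ‖y - z‖ := by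
          rw [← mul_assoc]; gcongr; exact le_max_right _ _

theorem eq_of_deriv_eq {g h : ℝ → ℝ} (hg : Differentiable ℝ g) (hh : Differentiable ℝ h)
    (hd : ∀ u, deriv g u = deriv h u) {t : ℝ} (ht : g t = h t) : g = h := by
  funext u
  have h1 := is_const_of_deriv_eq_zero (hg.sub hh) (fun u => by
    rw [deriv_sub (hg u) (hh u), hd u, sub_self]) u t
  simp only [Pi.sub_apply, ht, sub_self] at h1
  linarith

variable {f g : (Fin 2 → ℝ) → ℝ} {d : ℝ → ℝ} {X : Fin 2 → ℝ} {V : ℝ} {ξ ξ' : ℝ → Fin 2 → ℝ}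
  {ν ν' : ℝ → ℝ}

theorem SolvesGeodesic.pos_unique (hf : ContDiff ℝ ∞ f) (hd : Continuous d)
    (h : SolvesGeodesic f d X V ξ ν) (h' : SolvesGeodesic f d X V ξ' ν') : ξ = ξ' := by
  have key : ∀ {ξ : ℝ → Fin 2 → ℝ} {ν : ℝ → ℝ}, SolvesGeodesic f d X V ξ ν →
      (∀ u, HasDerivAt ξ (fun i => deriv (fun s => ξ s i) u) u) ∧
      ∀ u, HasDerivAt (fun u i => deriv (fun s => ξ s i) u) (d u • halfGrad f (ξ u)) u := by
    intro ξ ν h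
    have h1 : ∀ i, ContDiff ℝ ∞ fun s => ξ s i := fun i => contDiff_pi.1 h.smooth_pos i
    refine ⟨fun u => hasDerivAt_pi.2 fun i => ((h1 i).differentiable (by simp) u).hasDerivAt,
      fun u => hasDerivAt_pi.2 fun i => ?_⟩
    have h2 : ContDiff ℝ ∞ (deriv fun s => ξ s i) := (contDiff_infty_iff_deriv.1 (h1 i)).2
    have h3 := (h2.differentiable (by simp) u).hasDerivAt
    rw [h.eq_pos i u] at h3
    convert h3 using 1
    simp only [halfGrad, Pi.smul_apply, smul_eq_mul]
    ring
  exact secondOrder_unique (contDiff_halfGrad hf) hd (key h).1 (key h).2 (key h').1 (key h').2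
    (h.init_pos.trans h'.init_pos.symm)
    (funext fun i => (h.init_vel i).trans (h'.init_vel i).symm)

theorem SolvesGeodesic.v_unique (hf : ContDiff ℝ ∞ f) (hd : Continuous d)
    (h : SolvesGeodesic f d X V ξ ν) (h' : SolvesGeodesic f d X V ξ' ν') : ν = ν' := by
  have hξ := h.pos_unique hf hd h'
  subst hξ
  have h1 : deriv ν = deriv ν' :=
    eq_of_deriv_eq ((contDiff_infty_iff_deriv.1 h.smooth_v).2.differentiable (by simp))
      ((contDiff_infty_iff_deriv.1 h'.smooth_v).2.differentiable (by simp))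
      (fun u => (h.eq_v u).trans (h'.eq_v u).symm) (h.init_v_vel.trans h'.init_v_vel.symm)
  exact eq_of_deriv_eq (h.smooth_v.differentiable (by simp)) (h'.smooth_v.differentiable (by simp))
    (fun u => congrFun h1 u) (h.init_v.trans h'.init_v.symm)

/-- Only the values of the profile near the trajectory inside the support of `d` matter. -/
theorem SolvesGeodesic.congr_profile (h : SolvesGeodesic g d X V ξ ν) {ε : ℝ}
    (hd : ∀ u ∉ Icc (-ε) ε, d u = 0) (hfg : ∀ u ∈ Icc (-ε) ε, f =ᶠ[𝓝 (ξ u)] g) :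
    SolvesGeodesic f d X V ξ ν := by
  have hp : ∀ u ∈ Icc (-ε) ε, ∀ i, pderiv i f (ξ u) = pderiv i g (ξ u) := fun u hu i => by
    simp only [pderiv, (hfg u hu).fderiv_eq]
  refine ⟨h.smooth_pos, h.smooth_v, fun i u => ?_, fun u => ?_, h.init_pos, h.init_vel, h.init_v,
    h.init_v_vel⟩
  · rw [h.eq_pos i u]
    by_cases hu : u ∈ Icc (-ε) ε
    · rw [hp u hu]
    · simp [hd u hu]
  · rw [h.eq_v u]
    by_cases hu : u ∈ Icc (-ε) ε
    · simp only [hp u hu, (hfg u hu).eq_of_nhds]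
    · have h1 : d =ᶠ[𝓝 u] fun _ => 0 := by
        filter_upwards [isClosed_Icc.isOpen_compl.mem_nhds hu] with s hs using hd s hs
      simp [hd u hu, h1.deriv_eq]

end Uniqueness

/-! ### Removal of the cutoff and existence of asymptotic solutions. -/

section Existence

/-- Moderate nets that solve the geodesic equations for small `ε`, for all initial positions in a
given ball. -/
theorem exists_modNet_geodesic_on_closedBall {f : (Fin 2 → ℝ) → ℝ} (hf : ContDiff ℝ ∞ f)
    {δ : ℝ → ℝ → ℝ} (hδ : IsStrictDeltaNet δ) (hδm : ModNet δ) {R : ℝ} (hR : 0 ≤ R) :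
    ∃ (F : (Fin 2 → ℝ) → Fin 2 → ℝ) (x p : ℝ → (Fin 2 → ℝ) × ℝ → Fin 2 → ℝ)
      (w : ℝ → (Fin 2 → ℝ) × ℝ → ℝ) (A : ℝ), 0 ≤ A ∧ ModNet x ∧ ModNet w ∧ CBdd x ∧
      ∀ᶠ ε in 𝓝[>] (0 : ℝ), IsFlow F (δ ε) ε A (x ε) (p ε) ∧ ContDiff ℝ ∞ (w ε) ∧
        (∀ z, |w ε z| ≤ A * (1 + |z.2|)) ∧ ∀ X ∈ Metric.closedBall (0 : Fin 2 → ℝ) R, ∀ V,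
          SolvesGeodesic f (δ ε) X V (fun u => x ε (X, u)) (fun u => V + w ε (X, u)) := by
  -- For small ε trajectories move by less than 1 up to the end of the window and stay where χ = 1;
  -- afterwards δ vanishes and the profile no longer matters.
  let χ : ContDiffBump (0 : Fin 2 → ℝ) := ⟨R + 2, R + 3, by linarith, by linarith⟩
  obtain ⟨x, p, w, A, hA, hx, hw, hxb, h⟩ := exists_modNet_geodesic
    (f := fun y => χ y * f y) (χ.contDiff.mul hf) χ.hasCompactSupport.mul_right hδ hδm
  refine ⟨halfGrad fun y => χ y * f y, x, p, w, A, hA, hx, hw, hxb, ?_⟩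
  have hlim : Tendsto (fun ε : ℝ => A * (2 * ε)) (𝓝[>] 0) (𝓝 0) := by
    have h1 : Continuous fun ε : ℝ => A * (2 * ε) := by fun_prop
    simpa using (h1.tendsto 0).mono_left nhdsWithin_le_nhds
  filter_upwards [h, hlim.eventually_lt_const one_pos, eventually_mem_Ioc]
    with ε ⟨h1, h2, h3, h4⟩ h5 hε
  refine ⟨h1, h2, h3, fun X hX V => (h4 X V).congr_profile (ε := ε)
    (fun u hu => hδ.eq_zero hε fun h => hu (Ioo_subset_Icc_self h)) fun u hu => ?_⟩
  have h6 : ‖x ε (X, u) - X‖ ≤ A * (2 * ε) :=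
    (h1.norm_x_sub_le X u).trans (mul_le_mul_of_nonneg_left
      (max_le (by linarith [hu.2]) (by linarith [hε.1])) hA)
  have h7 : x ε (X, u) ∈ Metric.ball (0 : Fin 2 → ℝ) (R + 2) := by
    rw [mem_ball_zero_iff]
    have h8 := norm_add_le X (x ε (X, u) - X)
    rw [add_sub_cancel] at h8
    linarith [mem_closedBall_zero_iff.1 hX]
  filter_upwards [Metric.isOpen_ball.mem_nhds h7] with y hy
  rw [χ.one_of_mem_closedBall (Metric.ball_subset_closedBall hy), one_mul]

/-- N ε is the largest n ≤ ⌈ε⁻¹⌉ with P n ε. Each fixed n becomes admissible for small ε, so N ε → ∞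
without any monotonicity of P. -/
theorem exists_diagonal {P : ℕ → ℝ → Prop} (h : ∀ n, ∀ᶠ ε in 𝓝[>] (0 : ℝ), P n ε) :
    ∃ N : ℝ → ℕ, Tendsto N (𝓝[>] 0) atTop ∧ ∀ᶠ ε in 𝓝[>] (0 : ℝ), P (N ε) ε := by
  classical
  refine ⟨fun ε => Nat.findGreatest (fun n => P n ε) ⌈ε⁻¹⌉₊, ?_, ?_⟩
  · refine tendsto_atTop.2 fun n => ?_
    filter_upwards [h n, eventually_le_inv (n : ℝ)] with ε h1 h2
    exact Nat.le_findGreatest (by exact_mod_cast h2.trans (Nat.le_ceil _)) h1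
  · filter_upwards [h 0] with ε h1
    exact Nat.findGreatest_spec (P := fun n => P n ε) (Nat.zero_le _) h1

/-- There is a moderate asymptotic solution of the geodesic equations. -/
theorem exists_isAsymptoticSolution {f : (Fin 2 → ℝ) → ℝ} (hf : ContDiff ℝ ∞ f)
    {δ : ℝ → ℝ → ℝ} (hδ : IsStrictDeltaNet δ) (hδm : ModNet δ) :
    ∃ (x : ℝ → (Fin 2 → ℝ) × ℝ → Fin 2 → ℝ) (w : ℝ → (Fin 2 → ℝ) × ℝ → ℝ),
      ModNet x ∧ ModNet w ∧
        IsAsymptoticSolution f δ (fun ε X u => x ε (X, u)) (fun ε X V u => V + w ε (X, u)) := by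
  have H := fun n : ℕ => exists_modNet_geodesic_on_closedBall hf hδ hδm (R := n) n.cast_nonneg
  choose F x p w A hA hx hw hxb h using H
  let P : ℕ → ℝ → Prop := fun n ε => ContDiff ℝ ∞ (x n ε) ∧ ContDiff ℝ ∞ (w n ε) ∧
    ∀ X ∈ Metric.closedBall (0 : Fin 2 → ℝ) n, ∀ V,
      SolvesGeodesic f (δ ε) X V (fun u => x n ε (X, u)) (fun u => V + w n ε (X, u))
  have hP : ∀ n, ∀ᶠ ε in 𝓝[>] (0 : ℝ), P n ε := fun n => by
    filter_upwards [h n] with ε ⟨h1, h2, _, h4⟩ using ⟨h1.smooth_x, h2, h4⟩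
  obtain ⟨N, hN, hPN⟩ := exists_diagonal hP
  classical
  let x' : ℝ → (Fin 2 → ℝ) × ℝ → Fin 2 → ℝ := fun ε z => if P (N ε) ε then x (N ε) ε z else z.1
  let w' : ℝ → (Fin 2 → ℝ) × ℝ → ℝ := fun ε z => if P (N ε) ε then w (N ε) ε z else 0
  have hxs : ∀ ε, ContDiff ℝ ∞ (x' ε) := fun ε => by
    by_cases hε : P (N ε) ε
    · simpa only [x', if_pos hε] using hε.1
    · simpa only [x', if_neg hε] using contDiff_fst
  have hws : ∀ ε, ContDiff ℝ ∞ (w' ε) := fun ε => by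
    by_cases hε : P (N ε) ε
    · simpa only [w', if_pos hε] using hε.2.1
    · simpa only [w', if_neg hε] using contDiff_const
  have hsol : ∀ n : ℕ, ∀ᶠ ε in 𝓝[>] (0 : ℝ), ∀ X ∈ Metric.closedBall (0 : Fin 2 → ℝ) n, ∀ V,
      SolvesGeodesic f (δ ε) X V (fun u => x' ε (X, u)) (fun u => V + w' ε (X, u)) := fun n => by
    filter_upwards [hPN, hN.eventually_ge_atTop n] with ε h1 h2 X hX V
    simp only [x', w', if_pos h1]
    exact h1.2.2 X (Metric.closedBall_subset_closedBall (by exact_mod_cast h2) hX) V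
  -- Over a fixed ball, uniqueness of geodesics identifies the diagonal net with the n-th net for
  -- small ε, whose moderate bounds it inherits.
  have heq : ∀ n : ℕ, ∀ᶠ ε in 𝓝[>] (0 : ℝ), ∀ X ∈ Metric.closedBall (0 : Fin 2 → ℝ) n, ∀ u,
      x' ε (X, u) = x n ε (X, u) ∧ w' ε (X, u) = w n ε (X, u) := fun n => by
    filter_upwards [hP n, hsol n, eventually_mem_Ioc] with ε h1 h2 hε X hX u
    have hdc := (hδ.smooth ε hε).continuous
    refine ⟨congrFun ((h2 X hX 0).pos_unique hf hdc (h1.2.2 X hX 0)) u, ?_⟩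
    simpa using congrFun ((h2 X hX 0).v_unique hf hdc (h1.2.2 X hX 0)) u
  have hball : ∀ K : Set ((Fin 2 → ℝ) × ℝ), IsCompact K → ∃ n : ℕ,
      K ⊆ Metric.ball (0 : Fin 2 → ℝ) n ×ˢ univ := fun K hK => by
    obtain ⟨C, hC⟩ := hK.exists_bound_of_continuousOn (f := Prod.fst) continuous_fst.continuousOn
    obtain ⟨n, hn⟩ := exists_nat_gt C
    exact ⟨n, fun z hz => ⟨by simpa using (hC z hz).trans_lt hn, mem_univ _⟩⟩
  refine ⟨x', w', ModNet.of_eqOn (Eventually.of_forall hxs) fun K hK => ?_,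
    ModNet.of_eqOn (Eventually.of_forall hws) fun K hK => ?_, ?_⟩
  · obtain ⟨n, hn⟩ := hball K hK
    refine ⟨_, Metric.isOpen_ball.prod isOpen_univ, hn, x n, hx n, ?_⟩
    filter_upwards [heq n] with ε h1 z hz
    exact (h1 z.1 (Metric.ball_subset_closedBall hz.1) z.2).1
  · obtain ⟨n, hn⟩ := hball K hK
    refine ⟨_, Metric.isOpen_ball.prod isOpen_univ, hn, w n, hw n, ?_⟩
    filter_upwards [heq n] with ε h1 z hz
    exact (h1 z.1 (Metric.ball_subset_closedBall hz.1) z.2).2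
  · refine ⟨fun ε _ => hxs ε, fun ε _ => ?_, fun K hK => ?_⟩
    · have h1 : ContDiff ℝ ∞ fun q : (Fin 2 → ℝ) × ℝ × ℝ => w' ε (q.1, q.2.2) :=
        (hws ε).comp (by fun_prop)
      exact (contDiff_fst.comp contDiff_snd).add h1
    · obtain ⟨C, hC⟩ := hK.exists_bound_of_continuousOn (f := id) continuous_id.continuousOn
      obtain ⟨n, hn⟩ := exists_nat_gt C
      obtain ⟨e, he, hsub⟩ := mem_nhdsGT_iff_exists_Ioc_subset.1 (hsol n)
      refine ⟨min e 1, ⟨lt_min he one_pos, min_le_right _ _⟩, fun ε hε X hX V => ?_⟩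
      exact hsub ⟨hε.1, hε.2.trans (min_le_left _ _)⟩ X (by simpa using (hC X hX).trans hn.le) V

end Existence

/-! ### Moderate inverses of perturbations of the identity. -/

section ModerateInverse

variable {P B : Type*} [NormedAddCommGroup P] [NormedSpace ℝ P] [NormedAddCommGroup B]
  [NormedSpace ℝ B]

/-- Differentiating Ψ(p, Y p) = Y p gives (1 - ∂₂Ψ) ∘ Y' = ∂₁Ψ, and 1 - ∂₂Ψ is invertible by the
Neumann series. The right side involves only Y p, as `ModNet.of_fderiv_eq_comp` demands. -/
theorem fderiv_fixedPoint {Ψ : P × B → B} (hΨ : Differentiable ℝ Ψ) {Y : P → B}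
    (hY : ∀ p, Ψ (p, Y p) = Y p) {p : P} (hd : DifferentiableAt ℝ Y p) {κ : ℝ} (h0 : 0 ≤ κ)
    (h1 : κ < 1) (hL : ∀ y z, ‖Ψ (p, y) - Ψ (p, z)‖ ≤ κ * ‖y - z‖) [CompleteSpace B] :
    fderiv ℝ Y p = Ring.inverse (1 - fderiv ℝ Ψ (p, Y p) ∘L .inr ℝ P B) ∘L
      (fderiv ℝ Ψ (p, Y p) ∘L .inl ℝ P B) := by
  have hu : IsUnit (1 - fderiv ℝ Ψ (p, Y p) ∘L .inr ℝ P B) :=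
    isUnit_one_sub_of_norm_lt_one ((norm_fderiv_comp_inr_le (hΨ _) h0 hL).trans_lt h1)
  have h2 : HasFDerivAt (fun p => Ψ (p, Y p))
      (fderiv ℝ Ψ (p, Y p) ∘L (ContinuousLinearMap.id ℝ P).prod (fderiv ℝ Y p)) p :=
    (hΨ (p, Y p)).hasFDerivAt.comp p ((hasFDerivAt_id p).prodMk hd.hasFDerivAt)
  rw [funext hY] at h2
  have h3 := h2.fderiv
  have h4 : (1 - fderiv ℝ Ψ (p, Y p) ∘L .inr ℝ P B) ∘L fderiv ℝ Y p
      = fderiv ℝ Ψ (p, Y p) ∘L .inl ℝ P B := by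
    ext q
    have h5 := congrArg (fun T : P →L[ℝ] B => T q) h3
    have h6 : ((q, fderiv ℝ Y p q) : P × B) = (q, 0) + (0, fderiv ℝ Y p q) := by simp
    simp only [ContinuousLinearMap.comp_apply, ContinuousLinearMap.prod_apply,
      ContinuousLinearMap.id_apply] at h5
    rw [h6, map_add] at h5
    simp only [ContinuousLinearMap.comp_apply, sub_apply, one_apply_eq_self,
       ContinuousLinearMap.inr_apply, ContinuousLinearMap.inl_apply]
    rw [sub_eq_iff_eq_add]
    exact h5
  rw [← h4, ← ContinuousLinearMap.comp_assoc]
  have h7 := Ring.inverse_mul_cancel _ hu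
  rw [ContinuousLinearMap.mul_def] at h7
  rw [h7, ContinuousLinearMap.one_def, ContinuousLinearMap.id_comp]

/-- T ↦ (1 - T)⁻¹ is smooth on the unit ball, and its derivatives are bounded on the closed κ-ball,
which is compact in finite dimension. -/
theorem ModNet.inverse_one_sub [FiniteDimensional ℝ B] {u : ℝ → P → B →L[ℝ] B} (hu : ModNet u)
    {κ : ℝ} (h1 : κ < 1) (hκ : ∀ᶠ ε in 𝓝[>] (0 : ℝ), ∀ p, ‖u ε p‖ ≤ κ) :
    ModNet fun ε p => Ring.inverse (1 - u ε p) := by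
  have : CompleteSpace B := FiniteDimensional.complete ℝ B
  have : ProperSpace (B →L[ℝ] B) := FiniteDimensional.proper ℝ _
  have hs : ContDiffOn ℝ ∞ (fun T : B →L[ℝ] B => Ring.inverse (1 - T))
      (Metric.ball (0 : B →L[ℝ] B) 1) := by
    intro T hT
    obtain ⟨e, he⟩ := isUnit_one_sub_of_norm_lt_one (mem_ball_zero_iff.1 hT)
    have h2 : ContDiffAt ℝ ∞ Ring.inverse (1 - T) := by
      rw [← he]; exact contDiffAt_ringInverse ℝ e
    exact (h2.comp T (contDiffAt_const.sub contDiffAt_id)).contDiffWithinAt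
  refine hu.comp_of_polyBdd (g := fun _ T => Ring.inverse (1 - T)) Metric.isOpen_ball
    (hκ.mono fun ε h => ⟨hs, ?_⟩) fun K _ k => ?_
  · rintro _ ⟨p, rfl⟩
    exact mem_ball_zero_iff.2 ((h p).trans_lt h1)
  · have hc := hs.continuousOn_iteratedFDerivWithin (m := k) (by exact_mod_cast le_top)
      Metric.isOpen_ball.uniqueDiffOn
    obtain ⟨C, hC⟩ := (isCompact_closedBall (0 : B →L[ℝ] B) κ).exists_bound_of_continuousOn
      (hc.mono (Metric.closedBall_subset_ball h1))
    refine PolyBdd.of_le_const (C := C) (hκ.mono fun ε h p _ => ?_)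
    have h2 : u ε p ∈ Metric.closedBall (0 : B →L[ℝ] B) κ := by simpa using h p
    rw [← iteratedFDerivWithin_of_isOpen k Metric.isOpen_ball
      (Metric.closedBall_subset_ball h1 h2)]
    exact hC _ h2

/-- Fixed points of a moderate net of contractions depend moderately on the parameter. -/
theorem ModNet.fixedPoint [FiniteDimensional ℝ B] {Ψ : ℝ → P × B → B} (hΨ : ModNet Ψ)
    {κ : ℝ} (h0 : 0 ≤ κ) (h1 : κ < 1)
    (hL : ∀ᶠ ε in 𝓝[>] (0 : ℝ), ∀ p y z, ‖Ψ ε (p, y) - Ψ ε (p, z)‖ ≤ κ * ‖y - z‖)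
    {Y : ℝ → P → B} (hY : ∀ᶠ ε in 𝓝[>] (0 : ℝ), ∀ p, Ψ ε (p, Y ε p) = Y ε p)
    (hs : ∀ᶠ ε in 𝓝[>] (0 : ℝ), ContDiff ℝ ∞ (Y ε)) (hb : CBdd Y) : ModNet Y := by
  have : CompleteSpace B := FiniteDimensional.complete ℝ B
  have hr : ModNet fun ε z => _root_.fderiv ℝ (Ψ ε) z ∘L .inr ℝ P B :=
    hΨ.fderiv.clm_comp ((ContinuousLinearMap.compL ℝ B (P × B) B).flip (.inr ℝ P B))
  have hl : ModNet fun ε z => _root_.fderiv ℝ (Ψ ε) z ∘L .inl ℝ P B :=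
    hΨ.fderiv.clm_comp ((ContinuousLinearMap.compL ℝ P (P × B) B).flip (.inl ℝ P B))
  have hi : ModNet fun ε z => Ring.inverse (1 - _root_.fderiv ℝ (Ψ ε) z ∘L .inr ℝ P B) :=
    hr.inverse_one_sub h1 (by
      filter_upwards [hL, hΨ.smooth] with ε h2 h3 z
      exact norm_fderiv_comp_inr_le (h3.differentiable (by simp) _) h0 (h2 z.1))
  refine ModNet.of_fderiv_eq_comp (hi.bilin (ContinuousLinearMap.compL ℝ P B B) hl) hs hb ?_
  filter_upwards [hL, hY, hs, hΨ.smooth] with ε h2 h3 h4 h5 p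
  exact fderiv_fixedPoint (h5.differentiable (by simp)) h3 (h4.differentiable (by simp) p) h0 h1
    (h2 p)

variable {E : Type*} [NormedAddCommGroup E] [NormedSpace ℝ E] [FiniteDimensional ℝ E]

/-- A moderate net of perturbations of the identity by contractions, depending on a real parameter,
has a moderate net of inverses. -/
theorem exists_modNet_inverse {Z : ℝ → E × ℝ → E} (hZ : ModNet Z) (hs : ∀ ε, ContDiff ℝ ∞ (Z ε))
    (hL : ∀ ε X X' U, ‖(Z ε (X, U) - X) - (Z ε (X', U) - X')‖ ≤ 1 / 2 * ‖X - X'‖)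
    (hb : ∀ ε z, ‖Z ε z - z.1‖ ≤ 1 / 2) :
    ∃ χ : ℝ → E × ℝ → E, ModNet χ ∧ CBdd χ ∧ (∀ ε, ContDiff ℝ ∞ (χ ε)) ∧
      ∀ ε X U, χ ε (Z ε (X, U), U) = X := by
  have : CompleteSpace E := FiniteDimensional.complete ℝ E
  have : ProperSpace E := FiniteDimensional.proper ℝ E
  -- Solving Z(y, U) = X for y means y = X - (Z(y, U) - y), a ½-contraction in y.
  let Ψ : ℝ → (E × ℝ) × E → E := fun ε z => z.1.1 - (Z ε (z.2, z.1.2) - z.2)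
  have hΨs : ∀ ε, ContDiff ℝ ∞ (Ψ ε) := fun ε => by
    have h1 : ContDiff ℝ ∞ fun z : (E × ℝ) × E => Z ε (z.2, z.1.2) := (hs ε).comp (by fun_prop)
    exact (contDiff_fst.comp contDiff_fst).sub (h1.sub contDiff_snd)
  have hΨ : ModNet Ψ := (ModNet.of_contDiff (contDiff_fst.comp contDiff_fst)).sub
    ((hZ.comp_contDiff (u := fun z : (E × ℝ) × E => (z.2, z.1.2)) (by fun_prop)).sub
      (ModNet.of_contDiff contDiff_snd))
  have hlip : ∀ ε p y z, ‖Ψ ε (p, y) - Ψ ε (p, z)‖ ≤ 1 / 2 * ‖y - z‖ := fun ε p y z => by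
    simp only [Ψ, sub_sub_sub_cancel_left]
    rw [norm_sub_rev]
    exact hL ε y z p.2
  have hex : ∀ ε p, ∃ y, Ψ ε (p, y) = y := fun ε p =>
    exists_fixedPoint_of_norm_sub_le (fun y => Ψ ε (p, y)) (by norm_num) (by norm_num) (hlip ε p)
  choose χ hχ using hex
  have hχs : ∀ ε, ContDiff ℝ ∞ (χ ε) := fun ε => contDiff_iff_contDiffAt.2 fun p =>
    contDiffAt_fixedPoint (hΨs ε) isOpen_univ
      (fun p _ => ⟨1 / 2, by norm_num, by norm_num, hlip ε p⟩) (fun p _ => hχ ε p) (mem_univ p)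
  have hχb : CBdd χ := CBdd.of_norm_le fun K hK => by
    obtain ⟨C, hC⟩ := hK.exists_bound_of_continuousOn (f := Prod.fst) continuous_fst.continuousOn
    refine ⟨C + 1 / 2, Eventually.of_forall fun ε z hz => ?_⟩
    rw [← hχ ε z]
    exact (norm_sub_le _ _).trans (add_le_add (hC z hz) (hb ε (χ ε z, z.2)))
  refine ⟨χ, hΨ.fixedPoint (by norm_num) (by norm_num) (Eventually.of_forall hlip)
    (Eventually.of_forall hχ) (Eventually.of_forall hχs) hχb, hχb, hχs, fun ε X U => ?_⟩
  refine fixedPoint_unique_of_norm_sub_le (fun y => Ψ ε ((Z ε (X, U), U), y)) (by norm_num)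
    (hlip ε _) (hχ ε _) ?_
  simp [Ψ]

end ModerateInverse

/-! ### The generalized coordinate transformation is well defined. -/

section Transformation

theorem isNegligible_sub_of_eqOn {E : Type*} [NormedAddCommGroup E] [NormedSpace ℝ E] {U : Opens E}
    {u v : ℝ → E → ℝ} (hu : IsModerate U u) (hv : IsModerate U v)
    (h : ∀ K : Set E, IsCompact K → K ⊆ U → ∃ O : Set E, IsOpen O ∧ K ⊆ O ∧
      ∀ᶠ ε in 𝓝[>] (0 : ℝ), EqOn (u ε) (v ε) O) : IsNegligible U fun ε x => u ε x - v ε x where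
  smooth ε hε := (hu.smooth ε hε).sub (hv.smooth ε hε)
  decay K hK hKU k m := by
    obtain ⟨O, hO, hKO, huv⟩ := h K hK hKU
    refine ⟨0, huv.mono fun ε h1 x hx => ?_⟩
    have h2 : (fun x => u ε x - v ε x) =ᶠ[𝓝 x] fun _ => 0 := by
      filter_upwards [hO.mem_nhds (hKO hx)] with y hy
      rw [h1 hy, sub_self]
    rw [(h2.iteratedFDeriv ℝ k).eq_of_nhds]
    have h3 : (fun _ : E => (0 : ℝ)) = 0 := rfl
    rw [h3, iteratedFDeriv_zero]
    simp

theorem CBdd.pi {E ι : Type*} [NormedAddCommGroup E] [Fintype ι] {u : ℝ → E → ι → ℝ}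
    (h : ∀ j, CBdd fun ε x => u ε x j) : CBdd u := fun K hK => by
  choose L hL hKL using fun j => h j K hK
  refine ⟨Set.pi univ L, isCompact_univ_pi hL, ?_⟩
  filter_upwards [Filter.eventually_all.2 hKL] with ε h1 x hx j _ using h1 j hx

/-- The coordinates `(X, U)` of a point `(U, X, V)`. -/
def posTime (q : Fin 4 → ℝ) : (Fin 2 → ℝ) × ℝ := (![q 1, q 2], q 0)

theorem contDiff_posTime : ContDiff ℝ ∞ posTime := by
  refine ContDiff.prodMk (contDiff_pi.2 fun i => ?_) (contDiff_apply ℝ ℝ 0)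
  fin_cases i
  · exact contDiff_apply ℝ ℝ 1
  · exact contDiff_apply ℝ ℝ 2

theorem norm_posTime_fst_le (q : Fin 4 → ℝ) : ‖(posTime q).1‖ ≤ ‖q‖ := by
  rw [pi_norm_le_iff_of_nonneg (norm_nonneg _)]
  intro i
  fin_cases i
  · exact norm_le_pi_norm q 1
  · exact norm_le_pi_norm q 2

/-- The transformation determined by positions `x` and by `v = V + w`. -/
def shiftTransformation (x : (Fin 2 → ℝ) × ℝ → Fin 2 → ℝ) (w : (Fin 2 → ℝ) × ℝ → ℝ)
    (q : Fin 4 → ℝ) : Fin 4 → ℝ :=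
  ![q 0, x (posTime q) 0, x (posTime q) 1, q 3 + w (posTime q)]

theorem contDiff_shiftTransformation {x : (Fin 2 → ℝ) × ℝ → Fin 2 → ℝ} {w : (Fin 2 → ℝ) × ℝ → ℝ}
    (hx : ContDiff ℝ ∞ x) (hw : ContDiff ℝ ∞ w) (j : Fin 4) :
    ContDiff ℝ ∞ fun q => shiftTransformation x w q j := by
  have h1 := hx.comp contDiff_posTime
  have h2 := hw.comp contDiff_posTime
  fin_cases j
  · exact contDiff_apply ℝ ℝ 0
  · exact (contDiff_apply ℝ ℝ 0).comp h1
  · exact (contDiff_apply ℝ ℝ 1).comp h1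
  · exact (contDiff_apply ℝ ℝ 3).add h2

theorem ModNet.apply {E ι : Type*} [NormedAddCommGroup E] [NormedSpace ℝ E] [Fintype ι]
    {u : ℝ → E → ι → ℝ} (hu : ModNet u) (i : ι) : ModNet fun ε x => u ε x i :=
  hu.clm_comp (ContinuousLinearMap.proj i)

theorem modNet_shiftTransformation {x : ℝ → (Fin 2 → ℝ) × ℝ → Fin 2 → ℝ}
    {w : ℝ → (Fin 2 → ℝ) × ℝ → ℝ} (hx : ModNet x) (hw : ModNet w) (j : Fin 4) :
    ModNet fun ε q => shiftTransformation (x ε) (w ε) q j := by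
  have h1 := hx.comp_contDiff contDiff_posTime
  have h2 := hw.comp_contDiff contDiff_posTime
  fin_cases j
  · exact ModNet.of_contDiff (contDiff_apply ℝ ℝ 0)
  · exact h1.apply 0
  · exact h1.apply 1
  · exact (ModNet.of_contDiff (contDiff_apply ℝ ℝ 3)).add h2

theorem cBdd_shiftTransformation {x : ℝ → (Fin 2 → ℝ) × ℝ → Fin 2 → ℝ}
    {w : ℝ → (Fin 2 → ℝ) × ℝ → ℝ} (hx : CBdd x) (hw : CBdd w) :
    CBdd fun ε => shiftTransformation (x ε) (w ε) := by
  have h0 := CBdd.of_continuous contDiff_posTime.continuous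
  have hc : ∀ i : Fin 4, CBdd fun (_ : ℝ) (q : Fin 4 → ℝ) => q i := fun i =>
    CBdd.of_continuous (continuous_apply i)
  have h1 : ∀ i, CBdd fun ε q => x ε (posTime q) i := fun i =>
    (CBdd.of_continuous (continuous_apply (A := fun _ : Fin 2 => ℝ) i)).comp (hx.comp h0)
  have h2 : CBdd fun ε (q : Fin 4 → ℝ) => q 3 + w ε (posTime q) :=
    (CBdd.of_continuous (continuous_add (M := ℝ))).comp ((hc 3).prodMk (hw.comp h0))
  refine CBdd.pi fun j => ?_
  fin_cases j
  · exact hc 0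
  · exact h1 0
  · exact h1 1
  · exact h2

variable {f : (Fin 2 → ℝ) → ℝ} {δ : ℝ → ℝ → ℝ}

/-- Asymptotic solutions agree, for small `ε`, with any other solutions over a given ball. -/
theorem IsAsymptoticSolution.eventually_eqOn (hf : ContDiff ℝ ∞ f) (hδ : IsStrictDeltaNet δ)
    {x x' : ℝ → (Fin 2 → ℝ) → ℝ → Fin 2 → ℝ} {v v' : ℝ → (Fin 2 → ℝ) → ℝ → ℝ → ℝ}
    (h : IsAsymptoticSolution f δ x v) {R : ℝ}
    (h' : ∀ᶠ ε in 𝓝[>] (0 : ℝ), ∀ X ∈ Metric.closedBall (0 : Fin 2 → ℝ) R, ∀ V,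
      SolvesGeodesic f (δ ε) X V (x' ε X) (v' ε X V)) :
    ∀ᶠ ε in 𝓝[>] (0 : ℝ), EqOn (transformationNet x v ε) (transformationNet x' v' ε)
      {q | ‖(posTime q).1‖ ≤ R} := by
  obtain ⟨e, he, hs⟩ := h.solves _ (isCompact_closedBall (0 : Fin 2 → ℝ) R)
  filter_upwards [h', Ioc_mem_nhdsGT he.1, eventually_mem_Ioc] with ε h1 h2 hε q hq
  have hq' : ![q 1, q 2] ∈ Metric.closedBall (0 : Fin 2 → ℝ) R := by simpa [posTime] using hq
  have hdc := (hδ.smooth ε hε).continuous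
  have h3 := (hs ε h2 _ hq' (q 3)).pos_unique hf hdc (h1 _ hq' (q 3))
  have h4 := (hs ε h2 _ hq' (q 3)).v_unique hf hdc (h1 _ hq' (q 3))
  simp only [transformationNet, h3, h4]

theorem IsAsymptoticSolution.eventually_solves
    {x : ℝ → (Fin 2 → ℝ) → ℝ → Fin 2 → ℝ} {v : ℝ → (Fin 2 → ℝ) → ℝ → ℝ → ℝ}
    (h : IsAsymptoticSolution f δ x v) (R : ℝ) :
    ∀ᶠ ε in 𝓝[>] (0 : ℝ), ∀ X ∈ Metric.closedBall (0 : Fin 2 → ℝ) R, ∀ V,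
      SolvesGeodesic f (δ ε) X V (x ε X) (v ε X V) := by
  obtain ⟨e, he, hs⟩ := h.solves _ (isCompact_closedBall (0 : Fin 2 → ℝ) R)
  filter_upwards [Ioc_mem_nhdsGT he.1] with ε h2 using hs ε h2

theorem existsUnique_isCoordinateTransformation (hf : ContDiff ℝ ∞ f) (hδ : IsStrictDeltaNet δ)
    (hδm : IsModerate ⊤ δ) : ∃! T, IsCoordinateTransformation f δ T := by
  obtain ⟨x, w, hx, hw, hxw⟩ := exists_isAsymptoticSolution hf hδ hδm.modNet
  have hmod : ∀ j, IsModerate ⊤ fun ε q => transformationNet (fun ε X u => x ε (X, u))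
      (fun ε X V u => V + w ε (X, u)) ε q j := fun j => by
    refine (modNet_shiftTransformation hx hw j).isModerate (fun ε hε => ?_) ⊤
    refine contDiff_shiftTransformation (hxw.smooth_x ε hε) ?_ j
    -- Smoothness of w is recovered from that of V + w by setting V = 0.
    have h1 := (hxw.smooth_v ε hε).comp
      (contDiff_fst.prodMk (contDiff_const (c := (0 : ℝ)).prodMk contDiff_snd))
    simpa [Function.comp_def] using h1
  refine ⟨fun j => Colombeau.mk _ (hmod j), ⟨_, _, hxw, fun j => ⟨hmod j, rfl⟩⟩, ?_⟩
  rintro T ⟨x', v', h', hT⟩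
  funext j
  obtain ⟨hm, hj⟩ := hT j
  rw [hj]
  refine Quotient.sound (isNegligible_sub_of_eqOn hm (hmod j) fun K hK _ => ?_)
  obtain ⟨R, hR⟩ := hK.exists_bound_of_continuousOn (f := id) continuous_id.continuousOn
  refine ⟨Metric.ball 0 (R + 1), Metric.isOpen_ball, fun q hq => ?_, ?_⟩
  · have := hR q hq
    simp only [id] at this
    rw [mem_ball_zero_iff]
    linarith
  · filter_upwards [h'.eventually_eqOn hf hδ (hxw.eventually_solves (R + 1))] with ε h1 q hq
    exact congrFun (h1 ((norm_posTime_fst_le q).trans (mem_ball_zero_iff.1 hq).le)) j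

end Transformation

/-! ### Left invertibility. -/

section LeftInverse

/-- Time is capped only from above: at negative times the displacement estimates cost nothing, so
one α serves every β. -/
theorem exists_upperClamp {α : ℝ} (hα : 0 < α) : ∃ ψ : ℝ → ℝ, ContDiff ℝ ∞ ψ ∧
    (∀ r, ψ r ≤ 2 * α) ∧ ∀ r ≤ α, ψ r = r := by
  refine ⟨fun r => r * Real.smoothTransition (2 - r / α), ?_, fun r => ?_, fun r hr => ?_⟩
  · exact contDiff_id.mul (Real.smoothTransition.contDiff.comp (by fun_prop))
  · rcases le_total r (2 * α) with h | h
    · rcases le_total r 0 with h0 | h0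
      · exact (mul_nonpos_of_nonpos_of_nonneg h0 (Real.smoothTransition.nonneg _)).trans
          (by positivity)
      · exact (mul_le_of_le_one_right h0 (Real.smoothTransition.le_one _)).trans h
    · have : 2 - r / α ≤ 0 := by
        rw [sub_nonpos, le_div_iff₀ hα]; exact h
      simp only [Real.smoothTransition.zero_of_nonpos this, mul_zero]
      positivity
  · have : 1 ≤ 2 - r / α := by
      have : r / α ≤ 1 := (div_le_one hα).2 hr
      linarith
    simp only [Real.smoothTransition.one_of_one_le this, mul_one]

/-- Moderate nets of flows over the plane have, after a modification for large times, moderate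
left inverses. -/
theorem exists_modNet_leftInverse {F : (Fin 2 → ℝ) → Fin 2 → ℝ} {δ : ℝ → ℝ → ℝ}
    {x p : ℝ → (Fin 2 → ℝ) × ℝ → Fin 2 → ℝ} {w : ℝ → (Fin 2 → ℝ) × ℝ → ℝ} {A : ℝ} (hA : 0 ≤ A)
    (hx : ModNet x) (hw : ModNet w)
    (h : ∀ᶠ ε in 𝓝[>] (0 : ℝ), IsFlow F (δ ε) ε A (x ε) (p ε) ∧ ContDiff ℝ ∞ (w ε) ∧
      ∀ z, |w ε z| ≤ A * (1 + |z.2|)) {α : ℝ} (hα : 0 < α) (hAα : A * (3 * α) ≤ 1 / 2) :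
    ∃ t s : ℝ → (Fin 4 → ℝ) → Fin 4 → ℝ, (∀ ε q, s ε (t ε q) = q) ∧
      (∀ j, IsModerate ⊤ fun ε q => s ε q j) ∧ (∀ j, IsModerate ⊤ fun ε q => t ε q j) ∧ CBdd t ∧
      ∀ᶠ ε in 𝓝[>] (0 : ℝ), ∀ q : Fin 4 → ℝ, q 0 ≤ α →
        t ε q = shiftTransformation (x ε) (w ε) q := by
  classical
  obtain ⟨ψ, hψ, hψ2, hψ1⟩ := exists_upperClamp hα
  let P : ℝ → Prop := fun ε => IsFlow F (δ ε) ε A (x ε) (p ε) ∧ ContDiff ℝ ∞ (w ε) ∧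
    (∀ z, |w ε z| ≤ A * (1 + |z.2|)) ∧ ε ≤ α
  have hP : ∀ᶠ ε in 𝓝[>] (0 : ℝ), P ε := by
    filter_upwards [h, Ioc_mem_nhdsGT hα] with ε h1 h2 using ⟨h1.1, h1.2.1, h1.2.2, h2.2⟩
  have hψz : ContDiff ℝ ∞ fun z : (Fin 2 → ℝ) × ℝ => (z.1, ψ z.2) :=
    contDiff_fst.prodMk (hψ.comp contDiff_snd)
  -- The default values make the transformation the identity when `P ε` fails, so that the inversion
  -- holds exactly for every ε.
  let Z : ℝ → (Fin 2 → ℝ) × ℝ → Fin 2 → ℝ := fun ε z => if P ε then x ε (z.1, ψ z.2) else z.1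
  let Q : ℝ → (Fin 2 → ℝ) × ℝ → ℝ := fun ε z => if P ε then w ε (z.1, ψ z.2) else 0
  have hZs : ∀ ε, ContDiff ℝ ∞ (Z ε) := fun ε => by
    by_cases hε : P ε
    · simpa only [Z, if_pos hε, Function.comp_def] using hε.1.smooth_x.comp hψz
    · simpa only [Z, if_neg hε] using contDiff_fst
  have hQs : ∀ ε, ContDiff ℝ ∞ (Q ε) := fun ε => by
    by_cases hε : P ε
    · simpa only [Q, if_pos hε, Function.comp_def] using hε.2.1.comp hψz
    · simpa only [Q, if_neg hε] using contDiff_const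
  have hZm : ModNet Z := (hx.comp_contDiff hψz).congr (by
    filter_upwards [hP] with ε hε
    simp only [Z, if_pos hε])
  have hQm : ModNet Q := (hw.comp_contDiff hψz).congr (by
    filter_upwards [hP] with ε hε
    simp only [Q, if_pos hε])
  -- Here ψ U ≤ 2α and ε ≤ α, whence the 3α in the hypothesis.
  have hmax : ∀ ε, P ε → ∀ U, A * max (ψ U + ε) 0 ≤ 1 / 2 := fun ε hε U =>
    (mul_le_mul_of_nonneg_left (max_le (by linarith [hψ2 U, hε.2.2.2]) (by positivity)) hA).trans hAα
  have hZL : ∀ ε X X' U, ‖(Z ε (X, U) - X) - (Z ε (X', U) - X')‖ ≤ 1 / 2 * ‖X - X'‖ := by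
    intro ε X X' U
    by_cases hε : P ε
    · simp only [Z, if_pos hε]
      refine (hε.1.norm_displacement_sub_le X X' (ψ U)).trans ?_
      rw [mul_right_comm]
      exact mul_le_mul_of_nonneg_right (hmax ε hε U) (norm_nonneg _)
    · simp only [Z, if_neg hε, sub_self, norm_zero]
      positivity
  have hZ1 : ∀ ε z, ‖Z ε z - z.1‖ ≤ 1 / 2 := by
    intro ε z
    by_cases hε : P ε
    · simp only [Z, if_pos hε]
      exact (hε.1.norm_x_sub_le z.1 (ψ z.2)).trans (hmax ε hε z.2)
    · simp only [Z, if_neg hε, sub_self, norm_zero]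
      norm_num
  have hZb : CBdd Z := CBdd.of_norm_le fun K hK => by
    obtain ⟨C, hC⟩ := hK.exists_bound_of_continuousOn (f := Prod.fst) continuous_fst.continuousOn
    refine ⟨C + 1 / 2, Eventually.of_forall fun ε z hz => ?_⟩
    have h1 := norm_add_le z.1 (Z ε z - z.1)
    rw [add_sub_cancel] at h1
    exact h1.trans (add_le_add (hC z hz) (hZ1 ε z))
  have hQb : CBdd Q := CBdd.of_norm_le fun K hK => by
    obtain ⟨C, hC⟩ := hK.exists_bound_of_continuousOn (f := fun z : (Fin 2 → ℝ) × ℝ => ψ z.2)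
      (hψ.continuous.comp continuous_snd).continuousOn
    refine ⟨A * (1 + C), ?_⟩
    filter_upwards [hP] with ε hε z hz
    simp only [Q, if_pos hε, Real.norm_eq_abs]
    refine (hε.2.2.1 _).trans (mul_le_mul_of_nonneg_left ?_ hA)
    simpa using hC z hz
  obtain ⟨χ, hχm, hχb, hχs, hχ⟩ := exists_modNet_inverse hZm hZs hZL hZ1
  -- The shift of V is undone by subtracting it at the recovered initial position.
  let Q' : ℝ → (Fin 2 → ℝ) × ℝ → ℝ := fun ε z => -Q ε (χ ε z, z.2)
  have hpair : ModNet fun ε (z : (Fin 2 → ℝ) × ℝ) => (χ ε z, z.2) :=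
    hχm.prodMk (ModNet.of_contDiff contDiff_snd)
  have hQ' : ModNet Q' := (hQm.comp hpair (hχb.prodMk (CBdd.of_continuous continuous_snd))).neg
  have hQ's : ∀ ε, ContDiff ℝ ∞ (Q' ε) := fun ε =>
    ((hQs ε).comp ((hχs ε).prodMk contDiff_snd)).neg
  refine ⟨fun ε => shiftTransformation (Z ε) (Q ε), fun ε => shiftTransformation (χ ε) (Q' ε),
    fun ε q => ?_,
    fun j => (modNet_shiftTransformation hχm hQ' j).isModerate
      (fun ε _ => contDiff_shiftTransformation (hχs ε) (hQ's ε) j) ⊤,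
    fun j => (modNet_shiftTransformation hZm hQm j).isModerate
      (fun ε _ => contDiff_shiftTransformation (hZs ε) (hQs ε) j) ⊤,
    cBdd_shiftTransformation hZb hQb, ?_⟩
  · have h1 : posTime (shiftTransformation (Z ε) (Q ε) q) = (Z ε (posTime q), (posTime q).2) := by
      refine Prod.ext (funext fun i => ?_) rfl
      fin_cases i <;> rfl
    have h2 : χ ε (Z ε (posTime q), (posTime q).2) = (posTime q).1 := hχ ε _ _
    funext j
    change (![q 0, χ ε (posTime (shiftTransformation (Z ε) (Q ε) q)) 0,
      χ ε (posTime (shiftTransformation (Z ε) (Q ε) q)) 1, q 3 + Q ε (posTime q) +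
        Q' ε (posTime (shiftTransformation (Z ε) (Q ε) q))] : Fin 4 → ℝ) j = q j
    rw [h1]
    simp only [Q', h2]
    fin_cases j
    · rfl
    · rfl
    · rfl
    · change q 3 + Q ε (posTime q) + -Q ε (posTime q) = q 3
      ring
  · filter_upwards [hP] with ε hε q hq
    have h1 : ((posTime q).1, ψ (posTime q).2) = posTime q := Prod.ext rfl (hψ1 _ hq)
    simp only [shiftTransformation, Z, Q, if_pos hε, h1]

/-- On Ω the class of u is also represented by t, which is inverted globally and exactly; hence both
open sets in the definition can be the whole space. -/
theorem isLeftInvertibleOn_of_eqOn {n : ℕ} {T : Fin n → Colombeau (⊤ : Opens (Fin n → ℝ))}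
    {u t s : ℝ → (Fin n → ℝ) → Fin n → ℝ} (hT : IsRepresentative ⊤ u T) {Ω : Opens (Fin n → ℝ)}
    (hst : ∀ ε q, s ε (t ε q) = q) (hs : ∀ j, IsModerate ⊤ fun ε q => s ε q j)
    (ht : ∀ j, IsModerate ⊤ fun ε q => t ε q j) (hb : CBdd t)
    (h : ∀ᶠ ε in 𝓝[>] (0 : ℝ), EqOn (u ε) (t ε) Ω) : IsLeftInvertibleOn T Ω := by
  have hc : IsCBoundedNet Ω ⊤ t := by
    refine ⟨fun ε _ q _ => trivial, fun j => (ht j).mono le_top, fun K hK _ => ?_⟩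
    obtain ⟨L, hL, hKL⟩ := hb K hK
    obtain ⟨e, he, hsub⟩ := mem_nhdsGT_iff_exists_Ioc_subset.1 hKL
    exact ⟨L, hL, subset_univ _, min e 1, ⟨lt_min he one_pos, min_le_right _ _⟩,
      fun ε hε => hsub ⟨hε.1, hε.2.trans (min_le_left _ _)⟩⟩
  have hr : IsRepresentative Ω t fun j => (T j).restrict le_top := fun j => by
    obtain ⟨hm, hj⟩ := hT j
    refine ⟨(ht j).mono le_top, ?_⟩
    simp only [hj]
    refine (Quotient.sound (isNegligible_sub_of_eqOn ((ht j).mono le_top) (hm.mono le_top)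
      fun K _ hKΩ => ⟨Ω, Ω.isOpen, hKΩ, ?_⟩)).symm
    filter_upwards [h] with ε h1 q hq
    exact congrFun (h1 hq).symm j
  refine ⟨le_top, ⊤, fun j => Colombeau.mk _ (hs j), ⊤, le_rfl, ⟨t, hc, hr⟩, s, t,
    fun j => ⟨hs j, rfl⟩, hc, hr, fun j => ?_⟩
  have h1 : (fun ε q => s ε (t ε q) j) = fun (_ : ℝ) q => q j :=
    funext fun ε => funext fun q => congrFun (hst ε q) j
  rw [h1]
  exact ⟨_, rfl⟩

theorem exists_isLeftInvertibleOn {f : (Fin 2 → ℝ) → ℝ} {δ : ℝ → ℝ → ℝ} (hf : ContDiff ℝ ∞ f)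
    (hδ : IsStrictDeltaNet δ) (hδm : IsModerate ⊤ δ)
    {T : Fin 4 → Colombeau (⊤ : Opens (Fin 4 → ℝ))} (hT : IsCoordinateTransformation f δ T)
    (W : Opens (Fin 2 → ℝ)) (hW : IsCompact (closure (W : Set (Fin 2 → ℝ)))) :
    ∃ α > 0, ∀ β > 0, ∀ c d : ℝ, IsLeftInvertibleOn T (box (-β) α W c d) := by
  obtain ⟨x₀, v₀, h₀, hT⟩ := hT
  obtain ⟨R, hR⟩ := hW.exists_bound_of_continuousOn (f := id) continuous_id.continuousOn
  obtain ⟨F, x, p, w, A, hA, hx, hw, _, h⟩ := exists_modNet_geodesic_on_closedBall hf hδ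
    hδm.modNet (le_max_right R 0)
  have hα : 0 < 1 / (6 * (A + 1)) := by positivity
  -- This α satisfies A·3α ≤ ½. It depends on W only through the radius R that determines A, hence
  -- not on β or the interval.
  refine ⟨1 / (6 * (A + 1)), hα, fun β _ c d => ?_⟩
  obtain ⟨t, s, hst, hs, ht, hb, hteq⟩ := exists_modNet_leftInverse hA hx hw
    (h.mono fun ε h1 => ⟨h1.1, h1.2.1, h1.2.2.1⟩) hα (by
      rw [mul_one_div, mul_div_assoc', div_le_iff₀ (by positivity)]
      linarith)
  refine isLeftInvertibleOn_of_eqOn hT hst hs ht hb ?_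
  have heq := h₀.eventually_eqOn hf hδ (x' := fun ε X u => x ε (X, u))
    (v' := fun ε X V u => V + w ε (X, u)) (R := max R 0) (h.mono fun ε h1 => h1.2.2.2)
  filter_upwards [heq, hteq] with ε h1 h2 q hq
  have hqW : ‖(posTime q).1‖ ≤ max R 0 :=
    (hR _ (subset_closure hq.2.1)).trans (le_max_left _ _)
  exact (h1 hqW).trans (h2 q hq.1.2.le).symm

end LeftInverse

end PPWave

theorem corollary6p5 (f : (Fin 2 → ℝ) → ℝ) (hf : ContDiff ℝ ∞ f)
    (δ : ℝ → ℝ → ℝ) (hδ : PPWave.IsStrictDeltaNet δ)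
    (hδmod : PPWave.IsModerate (⊤ : TopologicalSpace.Opens ℝ) δ) :
    (∃! T : Fin 4 → PPWave.Colombeau (⊤ : TopologicalSpace.Opens (Fin 4 → ℝ)),
      PPWave.IsCoordinateTransformation f δ T) ∧
    ∀ T : Fin 4 → PPWave.Colombeau (⊤ : TopologicalSpace.Opens (Fin 4 → ℝ)),
      PPWave.IsCoordinateTransformation f δ T →
        ∀ W : TopologicalSpace.Opens (Fin 2 → ℝ), IsCompact (closure (W : Set (Fin 2 → ℝ))) →
          ∃ α > 0, ∀ β > 0, ∀ c d : ℝ,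
            PPWave.IsLeftInvertibleOn T (PPWave.box (-β) α W c d) :=
  ⟨PPWave.existsUnique_isCoordinateTransformation hf hδ hδmod, fun _ hT W hW =>
    PPWave.exists_isLeftInvertibleOn hf hδ hδmod hT W hW⟩
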